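/- **Definitions.** For a Dirichlet series $f(s)=\sum_{n\ge1}a_nn^{-s}$ let $\sigma_u(f)\in[-\infty,\infty]$ be the infimum of all real $\sigma$ such that the series converges uniformly on $\{\operatorname{Re}s>\sigma\}$. If $\sigma_u(f)\le 0$ and $\sigma>0$, put $$\|f_\sigma\|_0=\lim_{T\to\infty}\frac1{2T}\int_{-T}^{T}\log\bigl(1+|f(\sigma+it)|\bigr)\,dt$$ (the limit exists). Let $\mathcal N_u$ be the set of Dirichlet series $f$ with $\sigma_u(f)\le0$ and $\|f\|_0:=\sup_{\sigma>0}\|f_\sigma\|_0<\infty$, with the metric $d_0(f,g)=\|f-g\|_0$, and let the Nevanlinna–Dirichlet class $\mathcal N$ be the completion of $\mathcal N_u$ in $d_0$. Let $\mathbb D_1^\infty=\{\zeta\in\ell^1:|\zeta_n|<1\text{ for all }n\ge1\}$, an open subset of the complex Banach space $\ell^1$. A function $F:\mathbb D_1^\infty\to\mathbb C$ is holomorphic if it is locally bounded and $z\mapsto F(\zeta+z\xi)$ is holomorphic on $\{z\in\mathbb C:\zeta+z\xi\in\mathbb D_1^\infty\}$ for all $\zeta\in\mathbb D_1^\infty$,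 $\xi\in\ell^1$. Let $m_\infty$ be the normalized Haar measure of $\mathbb T^\infty$, and for $0<r<1$, $w\in\mathbb T^\infty$ put $F_{[r]}(w)=F(rw_1,r^2w_2,\dots,r^nw_n,\dots)$. Let $N(\mathbb D_1^\infty)$ be the class of holomorphic $F$ on $\mathbb D_1^\infty$ with $\sup_{0<r<1}\int_{\mathbb T^\infty}\log^+|F_{[r]}|\,dm_\infty<\infty$, with the metric $d_0(F,G)=\|F-G\|_0$, where $\|F\|_0=\sup_{0<r<1}\int_{\mathbb T^\infty}\log(1+|F_{[r]}|)\,dm_\infty$. For $n=p_1^{\alpha_1}\cdots p_k^{\alpha_k}$ ($p_j$ the $j$-th prime) write $\zeta^{\alpha(n)}=\zeta_1^{\alpha_1}\cdots\zeta_k^{\alpha_k}$. **Theorem 4.1.** For every Dirichlet series $f$ with $\sigma_u(f)\le 0$ and every $\sigma>0$, the limit defining $\|f_\sigma\|_0$ exists. Let $f(s)=\sum_{n\ge1}a_nn^{-s}$ be a Dirichlet series in $\mathcal N_u$. Then the series $(\mathcal Bf)(\zeta)=\sum_{n=1}^\infty a_n\zeta^{\alpha(n)}$ converges (absolutely) at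 every $\zeta\in\mathbb D_1^\infty$, its sum $\mathcal Bf$ belongs to $N(\mathbb D_1^\infty)$, and $\|\mathcal Bf\|_0=\|f\|_0$. Moreover, the map $\mathcal B:\mathcal N_u\to N(\mathbb D_1^\infty)$ extends, in a unique way, to an isometry $\mathcal N\to N(\mathbb D_1^\infty)$. -/

import Mathlib

open Set Filter Topology MeasureTheory
open scoped ENNReal

namespace BohrNevanlinna

/-! ### Dirichlet series

A Dirichlet series `∑_{n ≥ 1} a_n n^{-s}` is given by its coefficients, an `ArithmeticFunction ℂ`
(a function `a : ℕ → ℂ` with `a 0 = 0`). -/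

/-- The partial sum `∑_{n=1}^N a_n n^{-s}`. -/
noncomputable def partialSum (a : ArithmeticFunction ℂ) (N : ℕ) (s : ℂ) : ℂ :=
  ∑ n ∈ Finset.Icc 1 N, a n * (n : ℂ) ^ (-s)

/-- The series converges uniformly on the half plane `ℂ_σ = {s | σ < re s}`. -/
def ConvergesUniformlyOn (a : ArithmeticFunction ℂ) (σ : ℝ) : Prop :=
  ∃ g : ℂ → ℂ, TendstoUniformlyOn (partialSum a) g atTop {s : ℂ | σ < s.re}

/-- The abscissa of uniform convergence `σ_u`, an extended real number. -/
noncomputable def abscissaUnif (a : ArithmeticFunction ℂ) : EReal :=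
  sInf ((fun σ : ℝ => (σ : EReal)) '' {σ : ℝ | ConvergesUniformlyOn a σ})

/-- The sum `f(s) = lim_N ∑_{n=1}^N a_n n^{-s}` of the Dirichlet series, at points `s` at which the
partial sums converge. -/
noncomputable def dirichletSum (a : ArithmeticFunction ℂ) (s : ℂ) : ℂ :=
  limUnder atTop (fun N : ℕ => partialSum a N s)

/-- The average `(1/2T) ∫_{-T}^{T} log (1 + |f(σ+it)|) dt`. -/
noncomputable def verticalMean (a : ArithmeticFunction ℂ) (σ T : ℝ) : ℝ≥0∞ :=
  (∫⁻ t in Icc (-T) T,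
    ENNReal.ofReal (Real.log (1 + ‖dirichletSum a ((σ : ℂ) + (t : ℂ) * Complex.I)‖))) /
    ENNReal.ofReal (2 * T)

/-- `‖f_σ‖₀`, the mean of `log (1 + |f(σ+it)|)` over the vertical line of abscissa `σ`. It is written
as an upper limit as `T → ∞`, so that it makes sense for all `a` and `σ`; when `σ_u ≤ 0` and `σ > 0` it
is a limit. -/
noncomputable def lineNorm (a : ArithmeticFunction ℂ) (σ : ℝ) : ℝ≥0∞ :=
  limsup (fun T : ℝ => verticalMean a σ T) atTop

/-- `‖f‖₀ = sup_{σ > 0} ‖f_σ‖₀`. -/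
noncomputable def dirichletNorm (a : ArithmeticFunction ℂ) : ℝ≥0∞ :=
  ⨆ σ : Ioi (0 : ℝ), lineNorm a σ

/-- Membership in the class `𝒩_u`. -/
def MemNu (a : ArithmeticFunction ℂ) : Prop :=
  abscissaUnif a ≤ 0 ∧ dirichletNorm a < ⊤

/-- The class `𝒩_u` as a type. -/
def Nu : Type := {a : ArithmeticFunction ℂ // MemNu a}

theorem convergesUniformlyOn_of_pos {a : ArithmeticFunction ℂ} (h : abscissaUnif a ≤ 0)
    {σ : ℝ} (hσ : 0 < σ) : ConvergesUniformlyOn a σ := by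
  have h1 : abscissaUnif a < (σ : EReal) := lt_of_le_of_lt h (by exact_mod_cast hσ)
  obtain ⟨_, ⟨τ, ⟨g, hg⟩, rfl⟩, hτ⟩ := sInf_lt_iff.1 h1
  have hτ' : τ < σ := EReal.coe_lt_coe_iff.1 hτ
  exact ⟨g, hg.mono fun s (hs : σ < s.re) => hτ'.trans hs⟩

theorem abscissaUnif_le_zero {a : ArithmeticFunction ℂ}
    (h : ∀ σ : ℝ, 0 < σ → ConvergesUniformlyOn a σ) : abscissaUnif a ≤ 0 := by
  refine le_of_forall_gt_imp_ge_of_dense fun x hx => ?_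
  obtain ⟨q, hq0, hqx⟩ := EReal.lt_iff_exists_real_btwn.1 hx
  have hq : ConvergesUniformlyOn a q := h q (by exact_mod_cast hq0)
  have hle : abscissaUnif a ≤ (q : EReal) := sInf_le ⟨q, hq, rfl⟩
  exact hle.trans hqx.le

theorem partialSum_sub (a b : ArithmeticFunction ℂ) (N : ℕ) (s : ℂ) :
    partialSum (a - b) N s = partialSum a N s - partialSum b N s := by
  have h : ∀ n, (a - b) n = a n - b n := fun n => by
    rw [sub_eq_add_neg, sub_eq_add_neg]; rfl
  simp [partialSum, h, sub_mul, Finset.sum_sub_distrib]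

theorem tendsto_dirichletSum {a : ArithmeticFunction ℂ} (h : abscissaUnif a ≤ 0) {s : ℂ}
    (hs : 0 < s.re) :
    Tendsto (fun N : ℕ => partialSum a N s) atTop (𝓝 (dirichletSum a s)) := by
  obtain ⟨g, hg⟩ := convergesUniformlyOn_of_pos h (half_pos hs)
  exact tendsto_nhds_limUnder
    ⟨g s, hg.tendsto_at (show s.re / 2 < s.re by linarith)⟩

theorem abscissaUnif_sub {a b : ArithmeticFunction ℂ} (ha : abscissaUnif a ≤ 0)
    (hb : abscissaUnif b ≤ 0) : abscissaUnif (a - b) ≤ 0 := by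
  refine abscissaUnif_le_zero fun σ hσ => ?_
  obtain ⟨f, hf⟩ := convergesUniformlyOn_of_pos ha hσ
  obtain ⟨g, hg⟩ := convergesUniformlyOn_of_pos hb hσ
  refine ⟨f - g, ?_⟩
  have : partialSum (a - b) = partialSum a - partialSum b := by
    funext N s; exact partialSum_sub a b N s
  rw [this]
  exact hf.sub hg

theorem dirichletSum_sub {a b : ArithmeticFunction ℂ} (ha : abscissaUnif a ≤ 0)
    (hb : abscissaUnif b ≤ 0) {s : ℂ} (hs : 0 < s.re) :
    dirichletSum (a - b) s = dirichletSum a s - dirichletSum b s := by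
  refine tendsto_nhds_unique (tendsto_dirichletSum (abscissaUnif_sub ha hb) hs) ?_
  simp only [partialSum_sub]
  exact (tendsto_dirichletSum ha hs).sub (tendsto_dirichletSum hb hs)

/-- `log (1 + |x - y|) ≤ log (1 + |x - z|) + log (1 + |z - y|)`. -/
theorem log_triangle (x y z : ℂ) :
    ENNReal.ofReal (Real.log (1 + ‖x - y‖)) ≤
      ENNReal.ofReal (Real.log (1 + ‖x - z‖)) + ENNReal.ofReal (Real.log (1 + ‖z - y‖)) := by
  have h1 : (0 : ℝ) ≤ ‖x - z‖ := norm_nonneg _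
  have h2 : (0 : ℝ) ≤ ‖z - y‖ := norm_nonneg _
  have h3 : (0 : ℝ) ≤ ‖x - y‖ := norm_nonneg _
  have h4 : ‖x - y‖ ≤ ‖x - z‖ + ‖z - y‖ := norm_sub_le_norm_sub_add_norm_sub x z y
  rw [← ENNReal.ofReal_add (Real.log_nonneg (by linarith)) (Real.log_nonneg (by linarith)),
    ← Real.log_mul (by positivity) (by positivity)]
  refine ENNReal.ofReal_le_ofReal (Real.log_le_log (by positivity) ?_)
  nlinarith [mul_nonneg h1 h2]

theorem measurable_dirichletSum {a : ArithmeticFunction ℂ} (h : abscissaUnif a ≤ 0) {σ : ℝ}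
    (hσ : 0 < σ) : Measurable fun t : ℝ => dirichletSum a ((σ : ℂ) + (t : ℂ) * Complex.I) := by
  refine measurable_of_tendsto_metrizable (f := fun (N : ℕ) (t : ℝ) =>
    partialSum a N ((σ : ℂ) + (t : ℂ) * Complex.I)) (fun N => ?_) ?_
  · unfold partialSum
    fun_prop
  · rw [tendsto_pi_nhds]
    intro t
    exact tendsto_dirichletSum h (by simpa using hσ)

theorem limsup_add_le_ennreal (u v : ℝ → ℝ≥0∞) :
    limsup (fun T => u T + v T) atTop ≤ limsup u atTop + limsup v atTop := by
  rw [limsup_eq, limsup_eq, limsup_eq]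
  refine ENNReal.le_of_forall_pos_le_add fun ε hε hfin => ?_
  have hε' : (ε : ℝ≥0∞) / 2 ≠ 0 := by simp [hε.ne']
  obtain ⟨x, hx, hx'⟩ := sInf_lt_iff.1
    (ENNReal.lt_add_right (ENNReal.add_lt_top.1 hfin).1.ne hε')
  obtain ⟨y, hy, hy'⟩ := sInf_lt_iff.1
    (ENNReal.lt_add_right (ENNReal.add_lt_top.1 hfin).2.ne hε')
  have h1 : sInf {c | ∀ᶠ n in atTop, u n + v n ≤ c} ≤ x + y := by
    refine sInf_le ?_
    filter_upwards [hx, hy] with T h1 h2 using add_le_add h1 h2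
  refine h1.trans ((add_le_add hx'.le hy'.le).trans_eq ?_)
  rw [add_add_add_comm, ENNReal.add_halves]

theorem lineNorm_triangle {a b c : ArithmeticFunction ℂ} (ha : abscissaUnif a ≤ 0)
    (hb : abscissaUnif b ≤ 0) (hc : abscissaUnif c ≤ 0) {σ : ℝ} (hσ : 0 < σ) :
    lineNorm (a - b) σ ≤ lineNorm (a - c) σ + lineNorm (c - b) σ := by
  refine le_trans (limsup_le_limsup (Eventually.of_forall fun T => ?_)) (limsup_add_le_ennreal _ _)
  simp only [verticalMean]
  rw [← ENNReal.add_div]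
  refine ENNReal.div_le_div_right ?_ _
  rw [← lintegral_add_left]
  · refine lintegral_mono fun t => ?_
    have hs : 0 < ((σ : ℂ) + (t : ℂ) * Complex.I).re := by simpa using hσ
    rw [dirichletSum_sub ha hb hs, dirichletSum_sub ha hc hs, dirichletSum_sub hc hb hs]
    exact log_triangle _ _ _
  · have := measurable_dirichletSum (abscissaUnif_sub ha hc) hσ
    fun_prop

theorem dirichletNorm_triangle {a b c : ArithmeticFunction ℂ} (ha : abscissaUnif a ≤ 0)
    (hb : abscissaUnif b ≤ 0) (hc : abscissaUnif c ≤ 0) :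
    dirichletNorm (a - b) ≤ dirichletNorm (a - c) + dirichletNorm (c - b) :=
  iSup_le fun σ => (lineNorm_triangle ha hb hc σ.2).trans
    (add_le_add (le_iSup (fun σ : Ioi (0 : ℝ) => lineNorm (a - c) σ) σ)
      (le_iSup (fun σ : Ioi (0 : ℝ) => lineNorm (c - b) σ) σ))

theorem dirichletSum_zero (s : ℂ) : dirichletSum 0 s = 0 := by
  simp [dirichletSum, partialSum, tendsto_const_nhds.limUnder_eq]

theorem dirichletNorm_zero : dirichletNorm 0 = 0 := by
  simp [dirichletNorm, lineNorm, verticalMean, dirichletSum_zero]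

theorem abscissaUnif_zero : abscissaUnif 0 ≤ 0 :=
  abscissaUnif_le_zero fun σ _ => ⟨0, by
    have : partialSum 0 = fun _ => 0 := by funext N s; simp [partialSum]
    rw [this, Metric.tendstoUniformlyOn_iff]
    intro ε hε
    simp [hε]⟩

theorem dirichletNorm_sub_comm {a b : ArithmeticFunction ℂ} (ha : abscissaUnif a ≤ 0)
    (hb : abscissaUnif b ≤ 0) : dirichletNorm (a - b) = dirichletNorm (b - a) := by
  refine iSup_congr fun σ => ?_
  simp only [lineNorm, verticalMean]
  congr! 7 with T t
  have hs : 0 < (((σ : ℝ) : ℂ) + (t : ℂ) * Complex.I).re := by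
    have : (0 : ℝ) < σ := σ.2
    simpa using this
  rw [dirichletSum_sub ha hb hs, dirichletSum_sub hb ha hs, norm_sub_rev]

theorem dirichletNorm_sub_lt_top (f g : Nu) : dirichletNorm (f.1 - g.1) < ⊤ := by
  refine (dirichletNorm_triangle f.2.1 g.2.1 abscissaUnif_zero).trans_lt ?_
  rw [sub_zero, dirichletNorm_sub_comm abscissaUnif_zero g.2.1, sub_zero]
  exact ENNReal.add_lt_top.2 ⟨f.2.2, g.2.2⟩

/-- The distance `d₀(f, g) = ‖f - g‖₀` on `𝒩_u`. -/
noncomputable instance : PseudoMetricSpace Nu where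
  dist f g := (dirichletNorm (f.1 - g.1)).toReal
  dist_self f := by simp [dirichletNorm_zero]
  dist_comm f g := by rw [dirichletNorm_sub_comm f.2.1 g.2.1]
  dist_triangle f g h := by
    rw [← ENNReal.toReal_add (dirichletNorm_sub_lt_top f g).ne (dirichletNorm_sub_lt_top g h).ne]
    exact ENNReal.toReal_mono
      (ENNReal.add_lt_top.2 ⟨dirichletNorm_sub_lt_top f g, dirichletNorm_sub_lt_top g h⟩).ne
      (dirichletNorm_triangle f.2.1 h.2.1 g.2.1)

/-- The Nevanlinna–Dirichlet class `𝒩`: the completion of `𝒩_u` in the metric `d₀`. -/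
abbrev NevanlinnaDirichlet : Type := UniformSpace.Completion Nu

/-! ### Holomorphic functions on `𝔻₁^∞` -/

/-- A complex function on a subset `V` (in practice open) of a normed space is holomorphic if it is
locally bounded and holomorphic along complex lines. -/
def IsHolomorphic {X : Type*} [NormedAddCommGroup X] [NormedSpace ℂ X] {V : Set X}
    (F : V → ℂ) : Prop :=
  (∀ x : V, ∃ U ∈ 𝓝 x, ∃ M : ℝ, ∀ y ∈ U, ‖F y‖ ≤ M) ∧
  ∀ (x₀ : V) (x : X), DifferentiableOn ℂ
    (fun z : ℂ => Function.extend Subtype.val F 0 ((x₀ : X) + z • x)) {z : ℂ | (x₀ : X) + z • x ∈ V}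

/-- The Banach space `ℓ¹` of summable complex sequences, indexed from `0`. -/
abbrev Ell1 : Type := lp (fun _ : ℕ => ℂ) 1

/-- `𝔻₁^∞ = ℓ¹ ∩ 𝔻^∞`. -/
def D1 : Set Ell1 := {ζ | ∀ n, ‖ζ n‖ < 1}

theorem isOpen_D1 : IsOpen D1 := by
  rw [Metric.isOpen_iff]
  intro ζ hζ
  have hs : Summable fun n => ‖ζ n‖ := by
    simpa using (lp.memℓp ζ).summable (by simp)
  have ht : ∀ᶠ n in cofinite, ‖ζ n‖ < 1 / 2 :=
    hs.tendsto_cofinite_zero.eventually_lt_const (by norm_num)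
  have hfin : {n | ¬ ‖ζ n‖ < 1 / 2}.Finite := ht
  obtain ⟨r, hr, hr1⟩ : ∃ r < (1 : ℝ), ∀ n, ‖ζ n‖ ≤ r := by
    obtain ⟨r, hr, h⟩ : ∃ r < (1 : ℝ), ∀ n ∈ hfin.toFinset, ‖ζ n‖ ≤ r := by
      rcases hfin.toFinset.eq_empty_or_nonempty with h | h
      · exact ⟨0, by norm_num, fun n hn => by rw [h] at hn; exact absurd hn (Finset.notMem_empty n)⟩
      · obtain ⟨m, hm, hmax⟩ := hfin.toFinset.exists_max_image (fun n => ‖ζ n‖) h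
        exact ⟨‖ζ m‖, hζ m, hmax⟩
    refine ⟨max r (1 / 2), max_lt hr (by norm_num), fun n => ?_⟩
    by_cases hn : ‖ζ n‖ < 1 / 2
    · exact hn.le.trans (le_max_right _ _)
    · exact (h n (by simpa using hn)).trans (le_max_left _ _)
  refine ⟨1 - r, by linarith, fun η hη n => ?_⟩
  have h1 : ‖(η - ζ) n‖ ≤ ‖η - ζ‖ := lp.norm_apply_le_norm (by simp) _ n
  have h2 : ‖η - ζ‖ < 1 - r := by simpa [dist_eq_norm] using hη
  have h3 : ‖η n‖ ≤ ‖(η - ζ) n‖ + ‖ζ n‖ := by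
    simpa using norm_add_le ((η - ζ) n) (ζ n)
  linarith [hr1 n]

theorem IsHolomorphic.sub {X : Type*} [NormedAddCommGroup X] [NormedSpace ℂ X] {V : Set X}
    {F G : V → ℂ} (hF : IsHolomorphic F) (hG : IsHolomorphic G) : IsHolomorphic (F - G) := by
  refine ⟨fun x => ?_, fun x₀ x => ?_⟩
  · obtain ⟨U, hU, M, hM⟩ := hF.1 x
    obtain ⟨U', hU', M', hM'⟩ := hG.1 x
    exact ⟨U ∩ U', inter_mem hU hU', M + M', fun y hy =>
      (norm_sub_le _ _).trans (add_le_add (hM y hy.1) (hM' y hy.2))⟩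
  · refine ((hF.2 x₀ x).sub (hG.2 x₀ x)).congr fun z hz => ?_
    have h : ∀ H : V → ℂ, Function.extend Subtype.val H 0 ((x₀ : X) + z • x) = H ⟨_, hz⟩ :=
      fun H => Subtype.val_injective.extend_apply H 0 ⟨_, hz⟩
    simp [h]

/-- A holomorphic function on an open set is continuous. -/
theorem IsHolomorphic.continuous {X : Type*} [NormedAddCommGroup X] [NormedSpace ℂ X] {V : Set X}
    (hV : IsOpen V) {F : V → ℂ} (hF : IsHolomorphic F) : Continuous F := by
  rw [Metric.continuous_iff']
  intro x ε hε
  obtain ⟨U, hU, M, hM⟩ := hF.1 x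
  obtain ⟨δ₁, hδ₁, hδU⟩ := Metric.mem_nhds_iff.1 hU
  obtain ⟨δ₂, hδ₂, hδV⟩ := Metric.isOpen_iff.1 hV x x.2
  set δ := min δ₁ δ₂ with hδ
  have hδ0 : 0 < δ := lt_min hδ₁ hδ₂
  have hM0 : 0 ≤ M := (norm_nonneg _).trans (hM x (mem_of_mem_nhds hU))
  have hball : ∀ y : X, dist y x < δ → ∃ hy : y ∈ V, ‖F ⟨y, hy⟩‖ ≤ M := fun y hy => by
    have h1 : y ∈ V := hδV (hy.trans_le (min_le_right _ _))
    exact ⟨h1, hM _ (hδU (show dist (⟨y, h1⟩ : V) x < δ₁ from hy.trans_le (min_le_left _ _)))⟩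
  have hη : 0 < min δ (ε * δ / (2 * M + 1)) := by positivity
  filter_upwards [Metric.ball_mem_nhds x hη] with y hy
  have hy1 : dist (y : X) x < δ := lt_of_lt_of_le hy (min_le_left _ _)
  have hy2 : dist (y : X) x < ε * δ / (2 * M + 1) := lt_of_lt_of_le hy (min_le_right _ _)
  by_cases hxy : y = x
  · simpa [hxy] using hε
  have hd : 0 < dist (y : X) x := dist_pos.2 fun h => hxy (Subtype.ext h)
  set v : X := (y : X) - x with hv
  have hdv : dist (y : X) x = ‖v‖ := dist_eq_norm _ _
  set g : ℂ → ℂ := fun z => Function.extend Subtype.val F 0 ((x : X) + z • v) with hg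
  have hgv : ∀ z : ℂ, ∀ hz : (x : X) + z • v ∈ V, g z = F ⟨_, hz⟩ := fun z hz =>
    Subtype.val_injective.extend_apply F 0 ⟨_, hz⟩
  have hin : ∀ z ∈ Metric.ball (0 : ℂ) (δ / ‖v‖), dist ((x : X) + z • v) x < δ := fun z hz => by
    have : ‖z‖ < δ / ‖v‖ := by simpa using hz
    rw [lt_div_iff₀ (hdv ▸ hd)] at this
    simpa [dist_eq_norm, norm_smul] using this
  have hdiff : DifferentiableOn ℂ g (Metric.ball 0 (δ / ‖v‖)) :=
    (hF.2 x v).mono fun z hz => (hball _ (hin z hz)).1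
  have hx0 : ‖g 0‖ ≤ M := by
    obtain ⟨h1, h2⟩ := hball ((x : X) + (0 : ℂ) • v) (hin 0 (by
      have := hdv ▸ hd
      simp only [Metric.mem_ball, dist_self]; positivity))
    rwa [hgv 0 h1]
  have hmaps : MapsTo g (Metric.ball 0 (δ / ‖v‖)) (Metric.closedBall (g 0) (2 * M)) := by
    intro z hz
    obtain ⟨h1, h2⟩ := hball _ (hin z hz)
    rw [Metric.mem_closedBall, dist_eq_norm, hgv z h1]
    refine (norm_sub_le _ _).trans ?_
    linarith
  have h1mem : (1 : ℂ) ∈ Metric.ball (0 : ℂ) (δ / ‖v‖) := by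
    simp only [Metric.mem_ball, dist_zero_right, norm_one]
    rw [lt_div_iff₀ (hdv ▸ hd), one_mul, ← hdv]
    exact hy1
  have key := Complex.dist_le_div_mul_dist_of_mapsTo_ball hdiff hmaps h1mem
  have e1 : g 1 = F y := by
    have : (x : X) + (1 : ℂ) • v = y := by simp [hv]
    rw [hgv 1 (by rw [this]; exact y.2)]
    congr 1
    exact Subtype.ext this
  have e0 : g 0 = F x := by
    have : (x : X) + (0 : ℂ) • v = x := by simp
    rw [hgv 0 (by rw [this]; exact x.2)]
    congr 1
    exact Subtype.ext this
  rw [e1, e0] at key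
  refine key.trans_lt ?_
  have hvpos : 0 < ‖v‖ := hdv ▸ hd
  rw [hdv, lt_div_iff₀ (by positivity)] at hy2
  have : 2 * M / (δ / ‖v‖) * dist (1 : ℂ) 0 = 2 * M * ‖v‖ / δ := by
    rw [dist_zero_right, norm_one, mul_one, div_div_eq_mul_div]
  rw [this, div_lt_iff₀ hδ0]
  nlinarith

/-! ### The infinite torus and the Nevanlinna class

The torus `𝕋^∞` is parametrized by the angles `θ ∈ (ℝ/ℤ)^ℕ`, through `w_n = e^{2πi θ_n}`. -/

/-- The normalized Haar measure `m_∞` of the infinite torus: the product of the normalized Haar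
measures of the circles. -/
noncomputable def torusMeasure : Measure (ℕ → UnitAddCircle) :=
  Measure.infinitePi fun _ : ℕ => (AddCircle.haarAddCircle : Measure UnitAddCircle)

instance : IsProbabilityMeasure torusMeasure := by
  unfold torusMeasure
  infer_instance

theorem norm_dilate_apply {r : ℝ} (hr : r ∈ Ioo (0 : ℝ) 1) (θ : ℕ → UnitAddCircle) (n : ℕ) :
    ‖((r : ℂ) ^ (n + 1) * (AddCircle.toCircle (θ n) : ℂ))‖ = r ^ (n + 1) := by
  rw [norm_mul, Circle.norm_coe, mul_one, norm_pow, Complex.norm_real, Real.norm_of_nonneg hr.1.le]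

theorem summable_dilate {r : ℝ} (hr : r ∈ Ioo (0 : ℝ) 1) : Summable fun n : ℕ => r ^ (n + 1) :=
  (summable_nat_add_iff 1).2 (summable_geometric_of_lt_one hr.1.le hr.2)

/-- The point `(r w_1, r² w_2, r³ w_3, …)` of `𝔻₁^∞`, for `0 < r < 1` and `w ∈ 𝕋^∞`. Since sequences
are indexed from `0`, the factor in the coordinate of index `n` is `r ^ (n + 1)`. -/
noncomputable def dilate (r : Ioo (0 : ℝ) 1) (θ : ℕ → UnitAddCircle) : D1 :=
  ⟨⟨fun n => ((r : ℝ) : ℂ) ^ (n + 1) * (AddCircle.toCircle (θ n) : ℂ), memℓp_gen (by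
      simpa only [norm_dilate_apply r.2, ENNReal.toReal_one, Real.rpow_one]
        using summable_dilate r.2)⟩,
    fun n => by
      change ‖((r : ℝ) : ℂ) ^ (n + 1) * (AddCircle.toCircle (θ n) : ℂ)‖ < 1
      rw [norm_dilate_apply r.2]
      exact pow_lt_one₀ r.2.1.le r.2.2 (by omega)⟩

/-- `‖F‖₀ = sup_{0<r<1} ∫ log (1 + |F_[r]|) dm_∞`, where `F_[r](w) = F(r w_1, r² w_2, …)`. -/
noncomputable def nevanlinnaNorm (F : D1 → ℂ) : ℝ≥0∞ :=
  ⨆ r : Ioo (0 : ℝ) 1, ∫⁻ θ, ENNReal.ofReal (Real.log (1 + ‖F (dilate r θ)‖)) ∂torusMeasure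

/-- Membership in the Nevanlinna class `N(𝔻₁^∞)`: holomorphic functions `F` with
`sup_{0<r<1} ∫ log⁺ |F_[r]| dm_∞ < ∞`. -/
def MemNevanlinna (F : D1 → ℂ) : Prop :=
  IsHolomorphic F ∧
    ⨆ r : Ioo (0 : ℝ) 1, ∫⁻ θ, ENNReal.ofReal (Real.posLog ‖F (dilate r θ)‖) ∂torusMeasure < ⊤

/-- The Nevanlinna class `N(𝔻₁^∞)` as a type. -/
def Nevanlinna : Type := {F : D1 → ℂ // MemNevanlinna F}

theorem continuous_dilate (r : Ioo (0 : ℝ) 1) : Continuous (dilate r) := by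
  refine continuous_iff_continuousAt.2 fun θ₀ => ?_
  rw [ContinuousAt, tendsto_subtype_rng, tendsto_iff_norm_sub_tendsto_zero]
  have hnorm : ∀ θ, ‖((dilate r θ : D1) : Ell1) - (dilate r θ₀ : D1)‖ =
      ∑' n : ℕ, ‖((r : ℝ) : ℂ) ^ (n + 1) * (AddCircle.toCircle (θ n) : ℂ) -
        ((r : ℝ) : ℂ) ^ (n + 1) * (AddCircle.toCircle (θ₀ n) : ℂ)‖ := fun θ => by
    rw [lp.norm_eq_tsum_rpow (by simp)]
    simp only [ENNReal.toReal_one, Real.rpow_one, div_one]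
    rfl
  simp only [hnorm]
  have hc : Continuous fun θ : ℕ → UnitAddCircle =>
      ∑' n : ℕ, ‖((r : ℝ) : ℂ) ^ (n + 1) * (AddCircle.toCircle (θ n) : ℂ) -
        ((r : ℝ) : ℂ) ^ (n + 1) * (AddCircle.toCircle (θ₀ n) : ℂ)‖ := by
    refine continuous_tsum (u := fun n : ℕ => (r : ℝ) ^ (n + 1) + (r : ℝ) ^ (n + 1)) (fun n => ?_)
      ((summable_dilate r.2).add (summable_dilate r.2)) (fun n θ => ?_)
    · have h1 : Continuous fun θ : ℕ → UnitAddCircle => (AddCircle.toCircle (θ n) : ℂ) :=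
        continuous_subtype_val.comp (AddCircle.continuous_toCircle.comp (continuous_apply n))
      fun_prop
    · rw [norm_norm]
      refine (norm_sub_le _ _).trans_eq ?_
      rw [norm_dilate_apply r.2, norm_dilate_apply r.2]
  simpa using hc.tendsto θ₀

theorem measurable_dilate (r : Ioo (0 : ℝ) 1) (F : D1 → ℂ) (hF : Continuous F) :
    Measurable fun θ => F (dilate r θ) :=
  (hF.comp (continuous_dilate r)).measurable

theorem nevanlinnaNorm_triangle {F G H : D1 → ℂ} (hF : IsHolomorphic F) (hH : IsHolomorphic H) :
    nevanlinnaNorm (F - G) ≤ nevanlinnaNorm (F - H) + nevanlinnaNorm (H - G) := by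
  refine iSup_le fun r => le_trans ?_ (add_le_add
    (le_iSup (fun r : Ioo (0 : ℝ) 1 => ∫⁻ θ, ENNReal.ofReal
      (Real.log (1 + ‖(F - H) (dilate r θ)‖)) ∂torusMeasure) r)
    (le_iSup (fun r : Ioo (0 : ℝ) 1 => ∫⁻ θ, ENNReal.ofReal
      (Real.log (1 + ‖(H - G) (dilate r θ)‖)) ∂torusMeasure) r))
  rw [← lintegral_add_left]
  · exact lintegral_mono fun θ => log_triangle _ _ _
  · have := measurable_dilate r _ ((hF.sub hH).continuous isOpen_D1)
    fun_prop

theorem nevanlinnaNorm_sub_comm (F G : D1 → ℂ) :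
    nevanlinnaNorm (F - G) = nevanlinnaNorm (G - F) := by
  simp only [nevanlinnaNorm, Pi.sub_apply, norm_sub_rev]

theorem nevanlinnaNorm_lt_top {F : D1 → ℂ} (hF : MemNevanlinna F) : nevanlinnaNorm F < ⊤ := by
  have h : nevanlinnaNorm F ≤ ENNReal.ofReal (Real.log 2) +
      ⨆ r : Ioo (0 : ℝ) 1, ∫⁻ θ, ENNReal.ofReal (Real.posLog ‖F (dilate r θ)‖) ∂torusMeasure := by
    refine iSup_le fun r => le_trans ?_ (add_le_add_right
      (le_iSup (fun r : Ioo (0 : ℝ) 1 => ∫⁻ θ, ENNReal.ofReal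
        (Real.posLog ‖F (dilate r θ)‖) ∂torusMeasure) r) _)
    calc _ ≤ ∫⁻ θ, (ENNReal.ofReal (Real.log 2) +
          ENNReal.ofReal (Real.posLog ‖F (dilate r θ)‖)) ∂torusMeasure := by
          refine lintegral_mono fun θ => ?_
          rw [← ENNReal.ofReal_add (Real.log_nonneg (by norm_num)) Real.posLog_nonneg,
            Real.posLog_eq_log_max_one (norm_nonneg _),
            ← Real.log_mul (by norm_num) (by positivity)]
          refine ENNReal.ofReal_le_ofReal (Real.log_le_log (by positivity) ?_)
          linarith [le_max_left 1 ‖F (dilate r θ)‖, le_max_right 1 ‖F (dilate r θ)‖]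
      _ = _ := by
          rw [lintegral_add_left measurable_const]
          simp
  exact h.trans_lt (ENNReal.add_lt_top.2 ⟨ENNReal.ofReal_lt_top, hF.2⟩)

theorem isHolomorphic_zero : IsHolomorphic (0 : D1 → ℂ) := by
  refine ⟨fun x => ⟨univ, univ_mem, 0, by simp⟩, fun x₀ x => ?_⟩
  refine (differentiableOn_const 0).congr fun z hz => ?_
  exact Subtype.val_injective.extend_apply (0 : D1 → ℂ) 0 ⟨_, hz⟩

theorem nevanlinnaNorm_sub_lt_top (F G : Nevanlinna) : nevanlinnaNorm (F.1 - G.1) < ⊤ := by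
  refine (nevanlinnaNorm_triangle F.2.1 isHolomorphic_zero).trans_lt ?_
  rw [sub_zero, nevanlinnaNorm_sub_comm, sub_zero]
  exact ENNReal.add_lt_top.2 ⟨nevanlinnaNorm_lt_top F.2, nevanlinnaNorm_lt_top G.2⟩

/-- The distance `d₀(F, G) = ‖F - G‖₀` on `N(𝔻₁^∞)`. -/
noncomputable instance : PseudoMetricSpace Nevanlinna where
  dist F G := (nevanlinnaNorm (F.1 - G.1)).toReal
  dist_self F := by simp [nevanlinnaNorm]
  dist_comm F G := by rw [nevanlinnaNorm_sub_comm]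
  dist_triangle F G H := by
    rw [← ENNReal.toReal_add (nevanlinnaNorm_sub_lt_top F G).ne (nevanlinnaNorm_sub_lt_top G H).ne]
    exact ENNReal.toReal_mono
      (ENNReal.add_lt_top.2 ⟨nevanlinnaNorm_sub_lt_top F G, nevanlinnaNorm_sub_lt_top G H⟩).ne
      (nevanlinnaNorm_triangle F.2.1 G.2.1)

/-! ### The Bohr lift -/

/-- The monomial `ζ^{α(n)} = ∏_j ζ_j^{α_j}`, where `n = ∏_j p_j^{α_j}` and `p_j` is the `j`-th prime.
With indices from `0`, the index of a prime `p` is the number of primes less than `p`. -/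
noncomputable def bohrMonomial (n : ℕ) (ζ : Ell1) : ℂ :=
  n.factorization.prod fun p k => ζ (Nat.primeCounting' p) ^ k

/-- The Bohr lift `(ℬf)(ζ) = ∑_n a_n ζ^{α(n)}` as a function on `𝔻₁^∞`. -/
noncomputable def bohrLift (a : ArithmeticFunction ℂ) (ζ : D1) : ℂ :=
  ∑' n : ℕ, a n * bohrMonomial n ζ

end BohrNevanlinna

/-!
# The Bohr lift of the Nevanlinna–Dirichlet class

The points `(p_j^{-it})_j` of the Kronecker flow are equidistributed in `𝕋^∞` (`tendsto_flowMean`,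
by Stone–Weierstrass and unique factorization), hence dense. So the partial sums of a Dirichlet series
with `σ_u ≤ 0`, lifted to polynomials on the torus with radii `p_j^{-σ}`, converge uniformly to a
continuous function `G` (`exists_tendsto_linePoly`), and the mean of `log (1 + |f(σ + it)|)` exists and
equals `∫ log (1 + |G|) dm_∞` (`tendsto_verticalMean`).

Everything else rests on the subharmonicity of `log (1 + |h|)`, in each variable, for `h` analytic in
the polydisc. In one variable `log (1 + |g|)` is bounded on the disc by the real part of an entire
function which is almost equal to it on the circle (`exists_entire_majorant`); this gives the
monotonicity of means (`InPolydiscAlgebra.integral_dilate_le`) and, through Harnack's inequality, a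
bound of `log (1 + |h(z)|)` by `∏ (1 + |z_j|) / (1 - |z_j|)` times the mean over the torus
(`InPolydiscAlgebra.logOneAdd_le`).

* *Convergence.* Applied to the partial sums, the pointwise bound gives
  `|a_n| ρ^{α(n)} ≤ exp (K exp (∑ 2ρ_j / (1 - ρ_j)))` for radii `ρ` with finite support
  (`norm_coeff_mul_monomial_le_exp`). Given a point of `𝔻₁^∞`, one takes fixed radii for finitely many
  variables, and radii proportional to the exponents of `n` for the others; the multinomial theorem and
  `m^m ≤ e^m m!` then yield absolute convergence with a locally uniform bound
  (`exists_sum_monomial_le`).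
* *Equality of norms.* Since `p_j ≤ 2^j` for the `j`-th prime (Bertrand), the radii `r^j` with
  `r = 2^{-σ}` are at most `p_j^{-σ}`, so that the monotonicity of means gives `‖ℬf‖₀ ≤ ‖f‖₀`. For the
  converse, a partial sum involves finitely many variables, for which `p_j^{-σ} ≤ r^j` as soon as `r` is
  close to `1` (`integral_linePoly_le`).
* *Extension.* The pointwise bound for functions of the Nevanlinna class
  (`logOneAdd_le_nevanlinnaNorm`) is locally uniform in `𝔻₁^∞`. Therefore the class is Hausdorff and
  complete, and the isometry `ℬ` has exactly one isometric extension to the completion of `𝒩_u`.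
-/

namespace BohrNevanlinna

/-! ### Logarithmic means on the unit circle -/

/-- The function `x ↦ log (1 + |x|)` on `ℂ`. -/
noncomputable def logOneAdd (x : ℂ) : ℝ := Real.log (1 + ‖x‖)

theorem continuous_logOneAdd : Continuous logOneAdd := by
  unfold logOneAdd
  exact Continuous.log (by fun_prop) fun x => by positivity

theorem logOneAdd_nonneg (x : ℂ) : 0 ≤ logOneAdd x :=
  Real.log_nonneg (by linarith [norm_nonneg x])

theorem exp_logOneAdd (x : ℂ) : Real.exp (logOneAdd x) = 1 + ‖x‖ :=
  Real.exp_log (by positivity)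

theorem logOneAdd_le_norm (x : ℂ) : logOneAdd x ≤ ‖x‖ := by
  have := Real.log_le_sub_one_of_pos (x := 1 + ‖x‖) (by positivity)
  unfold logOneAdd
  linarith

theorem logOneAdd_add_le (x y : ℂ) : logOneAdd (x + y) ≤ logOneAdd x + logOneAdd y := by
  unfold logOneAdd
  rw [← Real.log_mul (by positivity) (by positivity)]
  refine Real.log_le_log (by positivity) ?_
  nlinarith [norm_add_le x y, norm_nonneg x, norm_nonneg y,
    mul_nonneg (norm_nonneg x) (norm_nonneg y)]

/-- The point `e^{2πiθ}` of the unit circle. -/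
noncomputable def expCircle (θ : UnitAddCircle) : ℂ := (AddCircle.toCircle θ : ℂ)

@[fun_prop]
theorem continuous_expCircle : Continuous expCircle :=
  continuous_subtype_val.comp AddCircle.continuous_toCircle

@[simp]
theorem norm_expCircle (θ : UnitAddCircle) : ‖expCircle θ‖ = 1 := Circle.norm_coe _

theorem expCircle_add (θ η : UnitAddCircle) :
    expCircle (θ + η) = expCircle θ * expCircle η := by
  simp [expCircle, AddCircle.toCircle_add]

theorem exists_expCircle_eq {z : ℂ} (hz : ‖z‖ = 1) : ∃ θ, expCircle θ = z := by
  obtain ⟨θ, hθ⟩ := (AddCircle.homeomorphCircle (T := 1) one_ne_zero).surjective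
    ⟨z, mem_sphere_zero_iff_norm.2 hz⟩
  refine ⟨θ, ?_⟩
  rw [AddCircle.homeomorphCircle_apply] at hθ
  simp [expCircle, hθ]

/-- The real part of a trigonometric polynomial is the restriction to the circle of the real part of
an entire function. The factor `c` makes the statement stable under complex multiples. -/
theorem exists_re_eq_of_mem_span_fourier {p : C(UnitAddCircle, ℂ)}
    (hp : p ∈ Submodule.span ℂ (range (@fourier (1 : ℝ)))) :
    ∀ c : ℂ, ∃ V : ℂ → ℂ, Differentiable ℂ V ∧ ∀ θ, (c * p θ).re = (V (expCircle θ)).re := by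
  induction hp using Submodule.span_induction with
  | mem x hx =>
    obtain ⟨k, rfl⟩ := hx
    intro c
    obtain ⟨k, rfl | rfl⟩ := k.eq_nat_or_neg
    · refine ⟨fun z => c * z ^ k, by fun_prop, fun θ => ?_⟩
      simp [fourier_apply, expCircle, AddCircle.toCircle_nsmul]
    · refine ⟨fun z => (starRingEnd ℂ) c * z ^ k, by fun_prop, fun θ => ?_⟩
      have h : (fourier (-(k : ℤ)) θ : ℂ) = (starRingEnd ℂ) (expCircle θ ^ k) := by
        simp [fourier_apply, expCircle, AddCircle.toCircle_nsmul, AddCircle.toCircle_neg,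
          ← Circle.coe_inv_eq_conj]
      rw [h, ← Complex.conj_re, map_mul, Complex.conj_conj]
  | zero => exact fun c => ⟨0, differentiable_const _, by simp⟩
  | add x y _ _ hx hy =>
    intro c
    obtain ⟨V, hV, hV'⟩ := hx c
    obtain ⟨W, hW, hW'⟩ := hy c
    refine ⟨V + W, hV.add hW, fun θ => ?_⟩
    simp [mul_add, ← hV', ← hW']
  | smul d x _ hx =>
    intro c
    obtain ⟨V, hV, hV'⟩ := hx (c * d)
    exact ⟨V, hV, fun θ => by rw [← hV', mul_assoc]; rfl⟩

/-- `log (1 + |g|)` has, up to `ε` on the circle, a majorant on the closed disc which is the real part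
of an entire function. As `1 + |g| = max_{|c| = 1} |1 + c g|`, it is enough to apply the maximum
principle to the functions `(1 + c g) e^{-V}`. -/
theorem exists_entire_majorant {g : ℂ → ℂ} (hg : DiffContOnCl ℂ g (Metric.ball 0 1)) {ε : ℝ}
    (hε : 0 < ε) :
    ∃ V : ℂ → ℂ, Differentiable ℂ V ∧ (∀ z, ‖z‖ ≤ 1 → logOneAdd (g z) ≤ (V z).re) ∧
      ∀ θ, (V (expCircle θ)).re ≤ logOneAdd (g (expCircle θ)) + ε := by
  have hgc : ContinuousOn g (Metric.closedBall 0 1) := by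
    rw [← closure_ball (0 : ℂ) one_ne_zero]; exact hg.continuousOn
  have hcont : Continuous fun θ => g (expCircle θ) :=
    hgc.comp_continuous continuous_expCircle fun θ => by simp
  let φ : C(UnitAddCircle, ℂ) :=
    ⟨fun θ => ((logOneAdd (g (expCircle θ)) + ε / 2 : ℝ) : ℂ), by
      have := continuous_logOneAdd.comp hcont
      exact Complex.continuous_ofReal.comp (this.add continuous_const)⟩
  have hφ : φ ∈ closure (Submodule.span ℂ (range (@fourier (1 : ℝ))) : Set C(UnitAddCircle, ℂ)) := by
    rw [← Submodule.topologicalClosure_coe, span_fourier_closure_eq_top]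
    trivial
  obtain ⟨p, hp, hpφ⟩ := Metric.mem_closure_iff.1 hφ (ε / 2) (half_pos hε)
  obtain ⟨V, hV, hVp⟩ := exists_re_eq_of_mem_span_fourier hp 1
  have hclose : ∀ θ, |logOneAdd (g (expCircle θ)) + ε / 2 - (V (expCircle θ)).re| < ε / 2 := by
    intro θ
    have h1 : ‖φ θ - p θ‖ < ε / 2 := by
      rw [← dist_eq_norm]
      exact (ContinuousMap.dist_apply_le_dist θ).trans_lt hpφ
    have h2 := (Complex.abs_re_le_norm _).trans_lt h1
    rw [← hVp θ, one_mul]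
    simpa [φ] using h2
  refine ⟨V, hV, fun z hz => ?_, fun θ => by linarith [(abs_lt.1 (hclose θ)).1]⟩
  obtain ⟨c, hc, hcz⟩ : ∃ c : ℂ, ‖c‖ = 1 ∧ c * g z = ‖g z‖ := by
    obtain ⟨c, hc, h⟩ := RCLike.exists_norm_eq_mul_self (g z)
    exact ⟨c, hc, h.symm⟩
  have hd : DiffContOnCl ℂ (fun z => (1 + c * g z) * Complex.exp (-V z)) (Metric.ball 0 1) := by
    have h1 : DiffContOnCl ℂ (fun z => 1 + c * g z) (Metric.ball 0 1) :=
      (hg.const_smul c).const_add 1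
    have h2 : DiffContOnCl ℂ (fun z => Complex.exp (-V z)) (Metric.ball 0 1) :=
      (by fun_prop : Differentiable ℂ fun z => Complex.exp (-V z)).diffContOnCl
    exact h1.smul h2
  have hmax := Complex.norm_le_of_forall_mem_frontier_norm_le Metric.isBounded_ball hd (C := 1)
    (fun x hx => ?_) (z := z) (by rw [closure_ball _ one_ne_zero]; simpa using hz)
  · rw [norm_mul, Complex.norm_exp, hcz] at hmax
    have h3 : ‖(1 : ℂ) + (‖g z‖ : ℂ)‖ = 1 + ‖g z‖ := by
      have : (1 : ℂ) + (‖g z‖ : ℂ) = ((1 + ‖g z‖ : ℝ) : ℂ) := by push_cast; rfl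
      rw [this, Complex.norm_real, Real.norm_of_nonneg (by positivity)]
    rw [h3, Complex.neg_re, Real.exp_neg, ← div_eq_mul_inv, div_le_one (Real.exp_pos _)] at hmax
    exact (Real.log_le_iff_le_exp (by positivity)).2 hmax
  · rw [frontier_ball _ one_ne_zero, mem_sphere_zero_iff_norm] at hx
    obtain ⟨θ, rfl⟩ := exists_expCircle_eq hx
    rw [norm_mul, Complex.norm_exp, Complex.neg_re, Real.exp_neg, ← div_eq_mul_inv,
      div_le_one (Real.exp_pos _)]
    calc ‖1 + c * g (expCircle θ)‖ ≤ 1 + ‖g (expCircle θ)‖ := by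
          refine (norm_add_le _ _).trans ?_
          rw [norm_mul, hc, norm_one, one_mul]
      _ = Real.exp (logOneAdd (g (expCircle θ))) := (exp_logOneAdd _).symm
      _ ≤ _ := Real.exp_le_exp.2 (by linarith [(abs_lt.1 (hclose θ)).2])

theorem integral_haarAddCircle_eq_circleAverage (f : ℂ → ℝ) :
    ∫ θ, f (expCircle θ) ∂(AddCircle.haarAddCircle : Measure UnitAddCircle) =
      Real.circleAverage f 0 1 := by
  have h1 : (volume : Measure UnitAddCircle) = AddCircle.haarAddCircle := by
    rw [AddCircle.volume_eq_smul_haarAddCircle]; simp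
  rw [← h1, ← AddCircle.intervalIntegral_preimage (1 : ℝ) 0, Real.circleAverage_def]
  have h2 := intervalIntegral.integral_comp_mul_left (a := 0) (b := 0 + 1)
    (fun x => f (circleMap 0 1 x)) (c := 2 * Real.pi) (by positivity)
  rw [mul_zero, zero_add, mul_one] at h2
  rw [← h2, zero_add]
  refine intervalIntegral.integral_congr fun x _ => ?_
  simp [expCircle, circleMap, AddCircle.toCircle_apply_mk, Circle.coe_exp]

/-- The mean value property of the real part of an entire function. -/
theorem integral_re_entire {V : ℂ → ℂ} (hV : Differentiable ℂ V) (s : ℝ) :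
    ∫ θ, (V (s * expCircle θ)).re ∂(AddCircle.haarAddCircle : Measure UnitAddCircle) =
      (V 0).re := by
  rw [integral_haarAddCircle_eq_circleAverage fun z => (V (s * z)).re]
  have h : Differentiable ℂ fun z => V (s * z) := by fun_prop
  have h1 := Complex.reCLM.circleAverage_comp_comm (f := fun z => V (s * z)) (c := 0) (R := 1)
    (h.continuous.continuousOn.circleIntegrable')
  have h2 := (h.diffContOnCl (s := Metric.ball (0 : ℂ) |1|)).circleAverage
  rw [h2] at h1
  simpa [Function.comp_def] using h1

/-- **Harnack's inequality** for the real part of an entire function. -/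
theorem re_entire_le {V : ℂ → ℂ} (hV : Differentiable ℂ V)
    (hV0 : ∀ θ, 0 ≤ (V (expCircle θ)).re) {z : ℂ} (hz : ‖z‖ < 1) :
    (V z).re ≤ (1 + ‖z‖) / (1 - ‖z‖) * (V 0).re := by
  have hzb : z ∈ Metric.ball (0 : ℂ) 1 := by simpa using hz
  have hsph : ∀ x ∈ Metric.sphere (0 : ℂ) |1|, x ∈ Metric.sphere (0 : ℂ) 1 := by simp
  have hP := (hV.diffContOnCl (s := Metric.ball (0 : ℂ) 1)).circleAverage_poissonKernel_smul hzb
  have hkc : ContinuousOn (poissonKernel 0 z) (Metric.sphere 0 |1|) := by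
    rw [poissonKernel_eq_re_herglotzRieszKernel]
    exact Complex.continuous_re.comp_continuousOn (continuousOn_herglotzRieszKernel_sphere hzb)
  have hk : ∀ x ∈ Metric.sphere (0 : ℂ) |1|, poissonKernel 0 z x ≤ (1 + ‖z‖) / (1 - ‖z‖) := by
    intro x hx
    have := re_herglotzRieszKernel_le (hsph x hx) hzb
    rw [poissonKernel_eq_re_herglotzRieszKernel]
    simpa [herglotzRieszKernel_def] using this
  have h1 := Complex.reCLM.circleAverage_comp_comm (f := poissonKernel 0 z • V) (c := 0) (R := 1)
    ((hkc.smul hV.continuous.continuousOn).circleIntegrable')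
  rw [hP] at h1
  have h0 := integral_re_entire hV 1
  simp only [Complex.ofReal_one, one_mul] at h0
  rw [integral_haarAddCircle_eq_circleAverage fun z => (V z).re] at h0
  rw [← h0, ← smul_eq_mul, ← Real.circleAverage_fun_smul]
  have hVr : ContinuousOn (fun z => (V z).re) (Metric.sphere 0 |1|) :=
    (Complex.continuous_re.comp hV.continuous).continuousOn
  change Complex.reCLM (V z) ≤ _
  rw [← h1]
  refine Real.circleAverage_mono ?_ ?_ fun x hx => ?_
  · exact (Complex.continuous_re.comp_continuousOn
      (hkc.smul hV.continuous.continuousOn)).circleIntegrable'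
  · exact (continuousOn_const.mul hVr).circleIntegrable'
  · have hx1 : ‖x‖ = 1 := by simpa using hx
    obtain ⟨θ, rfl⟩ := exists_expCircle_eq hx1
    simp only [Function.comp_apply, Pi.smul_apply', Complex.reCLM_apply, Complex.real_smul,
      Complex.re_ofReal_mul, smul_eq_mul]
    exact mul_le_mul_of_nonneg_right (hk _ hx) (hV0 θ)

theorem integrable_of_continuous {X E : Type*} [TopologicalSpace X] [CompactSpace X]
    [MeasurableSpace X] [OpensMeasurableSpace X] {μ : Measure X} [IsFiniteMeasure μ]
    [NormedAddCommGroup E] [SecondCountableTopologyEither X E] {f : X → E}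
    (hf : Continuous f) : Integrable f μ := by
  obtain ⟨C, hC⟩ := isCompact_univ.exists_bound_of_continuousOn hf.continuousOn
  exact Integrable.of_bound hf.aestronglyMeasurable C (Eventually.of_forall fun x => hC x trivial)

theorem logOneAdd_le_integral {g : ℂ → ℂ} (hg : DiffContOnCl ℂ g (Metric.ball 0 1)) {z : ℂ}
    (hz : ‖z‖ < 1) :
    logOneAdd (g z) ≤ (1 + ‖z‖) / (1 - ‖z‖) *
      ∫ θ, logOneAdd (g (expCircle θ)) ∂(AddCircle.haarAddCircle : Measure UnitAddCircle) := by
  have hgc : Continuous fun θ => logOneAdd (g (expCircle θ)) := by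
    refine continuous_logOneAdd.comp (ContinuousOn.comp_continuous
      (s := Metric.closedBall 0 1) ?_ continuous_expCircle fun θ => by simp)
    rw [← closure_ball (0 : ℂ) one_ne_zero]; exact hg.continuousOn
  have hc : 0 < (1 + ‖z‖) / (1 - ‖z‖) := div_pos (by positivity) (by linarith)
  refine le_of_forall_pos_le_add fun ε hε => ?_
  obtain ⟨V, hV, h1, h2⟩ := exists_entire_majorant hg (div_pos hε hc)
  have h3 : (V 0).re ≤ (∫ θ, logOneAdd (g (expCircle θ))
      ∂(AddCircle.haarAddCircle : Measure UnitAddCircle)) + ε / ((1 + ‖z‖) / (1 - ‖z‖)) := by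
    rw [← integral_re_entire hV 1]
    calc _ ≤ ∫ θ, (logOneAdd (g (expCircle θ)) + ε / ((1 + ‖z‖) / (1 - ‖z‖)))
          ∂(AddCircle.haarAddCircle : Measure UnitAddCircle) := by
          refine integral_mono (integrable_of_continuous ?_)
            (integrable_of_continuous (hgc.add continuous_const)) fun θ => by simpa using h2 θ
          exact Complex.continuous_re.comp (hV.continuous.comp (by fun_prop))
      _ = _ := by
          rw [integral_add (integrable_of_continuous hgc) (integrable_const _)]
          simp
  calc logOneAdd (g z) ≤ (V z).re := h1 z hz.le
    _ ≤ (1 + ‖z‖) / (1 - ‖z‖) * (V 0).re :=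
        re_entire_le hV (fun θ => (logOneAdd_nonneg _).trans (h1 _ (by simp))) hz
    _ ≤ _ := (mul_le_mul_of_nonneg_left h3 hc.le).trans_eq (by
        rw [mul_add, mul_div_cancel₀ _ hc.ne'])

/-- The means of `log (1 + |g|)` over concentric circles increase with the radius. -/
theorem integral_logOneAdd_mono {g : ℂ → ℂ} (hg : DiffContOnCl ℂ g (Metric.ball 0 1)) {s : ℝ}
    (hs : s ∈ Icc (0 : ℝ) 1) :
    ∫ θ, logOneAdd (g (s * expCircle θ)) ∂(AddCircle.haarAddCircle : Measure UnitAddCircle) ≤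
      ∫ θ, logOneAdd (g (expCircle θ)) ∂(AddCircle.haarAddCircle : Measure UnitAddCircle) := by
  have hgb : ContinuousOn g (Metric.closedBall 0 1) := by
    rw [← closure_ball (0 : ℂ) one_ne_zero]; exact hg.continuousOn
  have hsn : ∀ θ, ‖(s : ℂ) * expCircle θ‖ ≤ 1 := fun θ => by
    simpa [abs_of_nonneg hs.1] using hs.2
  have hgc : ∀ {s : ℝ}, (∀ θ, ‖(s : ℂ) * expCircle θ‖ ≤ 1) →
      Continuous fun θ => logOneAdd (g (s * expCircle θ)) := fun {s} hs =>
    continuous_logOneAdd.comp (hgb.comp_continuous (by fun_prop) fun θ => by simpa using hs θ)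
  have hg1 : Continuous fun θ => logOneAdd (g (expCircle θ)) := by
    simpa using hgc (s := 1) (by simp)
  refine le_of_forall_pos_le_add fun ε hε => ?_
  obtain ⟨V, hV, h1, h2⟩ := exists_entire_majorant hg hε
  have hVi : ∀ s : ℝ, Integrable (fun θ => (V (s * expCircle θ)).re)
      (AddCircle.haarAddCircle : Measure UnitAddCircle) := fun s => integrable_of_continuous
    (Complex.continuous_re.comp (hV.continuous.comp (by fun_prop)))
  calc _ ≤ ∫ θ, (V (s * expCircle θ)).re ∂(AddCircle.haarAddCircle : Measure UnitAddCircle) :=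
        integral_mono (integrable_of_continuous (hgc hsn)) (hVi s) fun θ => h1 _ (hsn θ)
    _ = ∫ θ, (V ((1 : ℝ) * expCircle θ)).re
        ∂(AddCircle.haarAddCircle : Measure UnitAddCircle) := by
        rw [integral_re_entire hV, integral_re_entire hV]
    _ ≤ ∫ θ, (logOneAdd (g (expCircle θ)) + ε)
        ∂(AddCircle.haarAddCircle : Measure UnitAddCircle) :=
        integral_mono (hVi 1) (integrable_of_continuous (hg1.add continuous_const))
          fun θ => by simpa using h2 θ
    _ = _ := by
        rw [integral_add (integrable_of_continuous hg1) (integrable_const _)]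
        simp

/-! ### The Haar measure of the infinite torus -/

/-- One coordinate of the torus can be integrated separately. -/
theorem measurePreserving_update (j : ℕ) :
    MeasurePreserving (fun p : (ℕ → UnitAddCircle) × UnitAddCircle => Function.update p.1 j p.2)
      (torusMeasure.prod AddCircle.haarAddCircle) torusMeasure := by
  have hm : Measurable fun p : (ℕ → UnitAddCircle) × UnitAddCircle =>
      Function.update p.1 j p.2 := measurable_update'
  refine ⟨hm, Measure.eq_infinitePi _ fun s t ht => ?_⟩
  rw [Measure.map_apply hm (.pi s.countable_toSet fun i _ => ht i)]
  have hpre : (fun p : (ℕ → UnitAddCircle) × UnitAddCircle => Function.update p.1 j p.2) ⁻¹'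
      (Set.pi (s : Set ℕ) t) =
      (Set.pi ((s.erase j : Finset ℕ) : Set ℕ) t) ×ˢ (if j ∈ s then t j else univ) := by
    ext ⟨w, θ⟩
    simp only [mem_preimage, Set.mem_pi, Finset.mem_coe, mem_prod, Finset.mem_erase]
    constructor
    · intro h
      refine ⟨fun i hi => by simpa [hi.1] using h i hi.2, ?_⟩
      split_ifs with hj
      · simpa using h j hj
      · trivial
    · rintro ⟨h1, h2⟩ i hi
      rcases eq_or_ne i j with rfl | hij
      · simpa [hi] using h2
      · simpa [hij] using h1 i ⟨hij, hi⟩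
  rw [hpre, Measure.prod_prod, torusMeasure, Measure.infinitePi_pi _ fun i _ => ht i]
  split_ifs with hj
  · rw [Finset.prod_erase_mul _ _ hj]
  · rw [measure_univ, mul_one, Finset.erase_eq_of_notMem hj]

theorem integral_torus_update {G : (ℕ → UnitAddCircle) → ℝ} (hG : Continuous G) (j : ℕ) :
    ∫ w, G w ∂torusMeasure =
      ∫ w, ∫ θ, G (Function.update w j θ) ∂AddCircle.haarAddCircle ∂torusMeasure := by
  have hc : Continuous fun p : (ℕ → UnitAddCircle) × UnitAddCircle =>
      G (Function.update p.1 j p.2) := hG.comp (continuous_fst.update j continuous_snd)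
  rw [← (measurePreserving_update j).map_eq, integral_map
    (measurePreserving_update j).measurable.aemeasurable hG.aestronglyMeasurable,
    integral_prod _ (integrable_of_continuous hc), (measurePreserving_update j).map_eq]

theorem measurePreserving_add_right (c : ℕ → UnitAddCircle) :
    MeasurePreserving (fun w => w + c) torusMeasure torusMeasure := by
  refine ⟨by fun_prop, ?_⟩
  have h := Measure.infinitePi_map_pi
    (fun _ : ℕ => (AddCircle.haarAddCircle : Measure UnitAddCircle))
    (f := fun i (x : UnitAddCircle) => x + c i) (fun i => by fun_prop)
  rw [torusMeasure]
  refine h.trans ?_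
  congr 1
  funext i
  exact map_add_right_eq_self _ _

instance : torusMeasure.IsOpenPosMeasure := by
  refine ⟨fun U hU hne => ?_⟩
  obtain ⟨w, hw⟩ := hne
  obtain ⟨I, u, hu, hIu⟩ := isOpen_pi_iff.1 hU w hw
  refine (lt_of_lt_of_le ?_ (measure_mono hIu)).ne'
  rw [torusMeasure, Measure.infinitePi_pi _ fun i hi => (hu i hi).1.measurableSet,
    pos_iff_ne_zero, Finset.prod_ne_zero_iff]
  exact fun i hi => ((hu i hi).1.measure_pos _ ⟨_, (hu i hi).2⟩).ne'

/-! ### Analytic functions on the infinite polydisc -/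

/-- The infinite closed polydisc `{z | |z_j| ≤ 1 for all j}`, with the product topology. -/
def closedPolydisc : Set (ℕ → ℂ) := {z | ∀ j, ‖z j‖ ≤ 1}

theorem isCompact_closedPolydisc : IsCompact closedPolydisc := by
  have : closedPolydisc = Set.pi univ fun _ : ℕ => Metric.closedBall (0 : ℂ) 1 := by
    ext z; simp [closedPolydisc]
  rw [this]
  exact isCompact_univ_pi fun _ => isCompact_closedBall 0 1

theorem update_mem_closedPolydisc {z : ℕ → ℂ} (hz : z ∈ closedPolydisc) (j : ℕ) {x : ℂ}
    (hx : ‖x‖ ≤ 1) : Function.update z j x ∈ closedPolydisc := by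
  intro i
  rcases eq_or_ne i j with rfl | hij
  · simpa using hx
  · simpa [hij] using hz i

/-- The polydisc algebra: functions which are continuous on the closed polydisc and analytic in each
variable separately. -/
structure InPolydiscAlgebra (h : (ℕ → ℂ) → ℂ) : Prop where
  continuousOn : ContinuousOn h closedPolydisc
  differentiableOn : ∀ z ∈ closedPolydisc, ∀ j,
    DifferentiableOn ℂ (fun x => h (Function.update z j x)) (Metric.ball 0 1)

/-- The point of the distinguished boundary of the polydisc with angles `w`. -/
noncomputable def torusPoint (w : ℕ → UnitAddCircle) : ℕ → ℂ := fun j => expCircle (w j)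

@[fun_prop]
theorem continuous_torusPoint : Continuous torusPoint :=
  continuous_pi fun j => continuous_expCircle.comp (continuous_apply j)

theorem torusPoint_update (w : ℕ → UnitAddCircle) (j : ℕ) (θ : UnitAddCircle) :
    torusPoint (Function.update w j θ) = Function.update (torusPoint w) j (expCircle θ) := by
  funext i
  rcases eq_or_ne i j with rfl | hij
  · simp [torusPoint]
  · simp [torusPoint, hij]

theorem torusPoint_mem (w : ℕ → UnitAddCircle) : torusPoint w ∈ closedPolydisc := fun j => by
  simp [torusPoint]

namespace InPolydiscAlgebra

variable {h : (ℕ → ℂ) → ℂ}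

theorem sub {g : (ℕ → ℂ) → ℂ} (hh : InPolydiscAlgebra h) (hg : InPolydiscAlgebra g) :
    InPolydiscAlgebra fun z => h z - g z :=
  ⟨hh.1.sub hg.1, fun z hz j => (hh.2 z hz j).sub (hg.2 z hz j)⟩

theorem diffContOnCl (hh : InPolydiscAlgebra h) {z : ℕ → ℂ} (hz : z ∈ closedPolydisc) (j : ℕ) :
    DiffContOnCl ℂ (fun x => h (Function.update z j x)) (Metric.ball 0 1) := by
  refine ⟨hh.2 z hz j, ?_⟩
  rw [closure_ball _ one_ne_zero]
  have hc : Continuous fun x : ℂ => Function.update z j x := continuous_const.update j continuous_id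
  refine hh.1.comp hc.continuousOn fun x hx => ?_
  exact update_mem_closedPolydisc hz j (by simpa using hx)

theorem exists_logOneAdd_le (hh : InPolydiscAlgebra h) :
    ∃ C : ℝ, ∀ z ∈ closedPolydisc, logOneAdd (h z) ≤ C := by
  obtain ⟨C, hC⟩ := isCompact_closedPolydisc.exists_bound_of_continuousOn hh.1
  exact ⟨C, fun z hz => (logOneAdd_le_norm _).trans (hC z hz)⟩

theorem continuous_logOneAdd_comp (hh : InPolydiscAlgebra h) {X : Type*} [TopologicalSpace X]
    {f : X → ℕ → ℂ} (hf : Continuous f) (hf' : ∀ x, f x ∈ closedPolydisc) :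
    Continuous fun x => logOneAdd (h (f x)) :=
  continuous_logOneAdd.comp (hh.1.comp_continuous hf hf')

/-- Passage to the limit in the mean of `log (1 + |h|)`. -/
theorem tendsto_integral (hh : InPolydiscAlgebra h) {f : ℕ → (ℕ → UnitAddCircle) → ℕ → ℂ}
    {g : (ℕ → UnitAddCircle) → ℕ → ℂ} (hf : ∀ m, Continuous (f m))
    (hfK : ∀ m w, f m w ∈ closedPolydisc) (hgK : ∀ w, g w ∈ closedPolydisc)
    (hlim : ∀ w j, ∀ᶠ m in atTop, f m w j = g w j) :
    Tendsto (fun m => ∫ w, logOneAdd (h (f m w)) ∂torusMeasure) atTop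
      (𝓝 (∫ w, logOneAdd (h (g w)) ∂torusMeasure)) := by
  obtain ⟨C, hC⟩ := hh.exists_logOneAdd_le
  refine tendsto_integral_of_dominated_convergence (fun _ => C)
    (fun m => (hh.continuous_logOneAdd_comp (hf m) (hfK m)).aestronglyMeasurable)
    (integrable_const _) (fun m => Eventually.of_forall fun w => ?_)
    (Eventually.of_forall fun w => ?_)
  · rw [Real.norm_of_nonneg (logOneAdd_nonneg _)]
    exact hC _ (hfK m w)
  · refine (continuous_logOneAdd.tendsto _).comp ?_
    refine (hh.1 (g w) (hgK w)).tendsto.comp (tendsto_nhdsWithin_iff.2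
      ⟨tendsto_pi_nhds.2 fun j => ?_, Eventually.of_forall fun m => hfK m w⟩)
    exact tendsto_const_nhds.congr' ((hlim w j).mono fun m hm => hm.symm)

/-- The mean of `log (1 + |h|)` over a torus decreases when the radii decrease. -/
theorem integral_dilate_le (hh : InPolydiscAlgebra h) {s : ℕ → ℝ}
    (hs : ∀ j, s j ∈ Icc (0 : ℝ) 1) :
    ∫ w, logOneAdd (h fun j => s j * torusPoint w j) ∂torusMeasure ≤
      ∫ w, logOneAdd (h (torusPoint w)) ∂torusMeasure := by
  -- The radii are decreased one after the other.
  let S : ℕ → (ℕ → UnitAddCircle) → ℕ → ℂ := fun m w j =>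
    (if j < m then (s j : ℂ) else 1) * torusPoint w j
  have hSc : ∀ m, Continuous (S m) := fun m => continuous_pi fun j => by
    have := (continuous_apply j).comp continuous_torusPoint
    exact continuous_const.mul this
  have hSK : ∀ m w, S m w ∈ closedPolydisc := fun m w j => by
    have h1 : ‖torusPoint w j‖ = 1 := norm_expCircle _
    simp only [S, norm_mul, h1, mul_one]
    split_ifs
    · simpa [abs_of_nonneg (hs j).1] using (hs j).2
    · simp
  have hstep : ∀ m, ∫ w, logOneAdd (h (S m w)) ∂torusMeasure ≤
      ∫ w, logOneAdd (h (torusPoint w)) ∂torusMeasure := by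
    intro m
    induction m with
    | zero => simp [S]
    | succ m ih =>
      refine le_trans ?_ ih
      rw [integral_torus_update (hh.continuous_logOneAdd_comp (hSc _) (hSK _)) m,
        integral_torus_update (hh.continuous_logOneAdd_comp (hSc m) (hSK m)) m]
      have e1 : ∀ w θ, S (m + 1) (Function.update w m θ) =
          Function.update (S (m + 1) w) m (s m * expCircle θ) := fun w θ => by
        funext i
        rcases eq_or_ne i m with rfl | hi
        · simp [S, torusPoint_update]
        · simp [S, torusPoint_update, hi]
      have e2 : ∀ w θ, S m (Function.update w m θ) =
          Function.update (S (m + 1) w) m (expCircle θ) := fun w θ => by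
        funext i
        rcases eq_or_ne i m with rfl | hi
        · simp [S, torusPoint_update]
        · have : i ≤ m ↔ i < m := by omega
          simp [S, torusPoint_update, hi, this]
      have hi : ∀ m', Integrable (fun w => ∫ θ, logOneAdd (h (S m' (Function.update w m θ)))
          ∂AddCircle.haarAddCircle) torusMeasure := fun m' =>
        (integrable_of_continuous ((hh.continuous_logOneAdd_comp (hSc m') (hSK m')).comp
          (continuous_fst.update m continuous_snd))).integral_prod_left
      refine integral_mono (hi _) (hi _) fun w => ?_
      simp only [e1, e2]
      exact integral_logOneAdd_mono (hh.diffContOnCl (hSK (m + 1) w) m) (hs m)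
  refine le_of_tendsto' (hh.tendsto_integral hSc hSK (g := fun w j => s j * torusPoint w j)
    (fun w j => ?_) fun w j => ?_) hstep
  · simpa [torusPoint, abs_of_nonneg (hs j).1] using (hs j).2
  · filter_upwards [eventually_gt_atTop j] with m hm
    simp [S, hm]

/-- Pointwise bound of `log (1 + |h|)` inside the polydisc by its mean over the torus. -/
theorem logOneAdd_le (hh : InPolydiscAlgebra h) {z : ℕ → ℂ} (hz : ∀ j, ‖z j‖ < 1) {C : ℝ}
    (hC : ∀ m, ∏ j ∈ Finset.range m, (1 + ‖z j‖) / (1 - ‖z j‖) ≤ C) :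
    logOneAdd (h z) ≤ C * ∫ w, logOneAdd (h (torusPoint w)) ∂torusMeasure := by
  -- The coordinates of `z` are moved to the unit circle one after the other.
  let S : ℕ → (ℕ → UnitAddCircle) → ℕ → ℂ := fun m w j => if j < m then torusPoint w j else z j
  have hSc : ∀ m, Continuous (S m) := fun m => continuous_pi fun j => by
    have : Continuous fun w => torusPoint w j := (continuous_apply j).comp continuous_torusPoint
    by_cases hj : j < m
    · simpa [S, hj] using this
    · simpa [S, hj] using continuous_const
  have hSK : ∀ m w, S m w ∈ closedPolydisc := fun m w j => by
    simp only [S]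
    split_ifs
    · exact torusPoint_mem w j
    · exact (hz j).le
  have hstep : ∀ m, logOneAdd (h z) ≤ (∏ j ∈ Finset.range m, (1 + ‖z j‖) / (1 - ‖z j‖)) *
      ∫ w, logOneAdd (h (S m w)) ∂torusMeasure := by
    intro m
    induction m with
    | zero => simp [S]
    | succ m ih =>
      refine ih.trans ?_
      rw [Finset.prod_range_succ, mul_assoc]
      refine mul_le_mul_of_nonneg_left ?_ (Finset.prod_nonneg fun j _ =>
        div_nonneg (by positivity) (by linarith [hz j]))
      rw [integral_torus_update (hh.continuous_logOneAdd_comp (hSc (m + 1)) (hSK (m + 1))) m,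
        ← integral_const_mul]
      have e1 : ∀ w θ, S (m + 1) (Function.update w m θ) =
          Function.update (S m w) m (expCircle θ) := fun w θ => by
        funext i
        rcases eq_or_ne i m with rfl | hi
        · simp [S, torusPoint_update]
        · have : i ≤ m ↔ i < m := by omega
          simp [S, torusPoint_update, hi, this]
      have hi : Integrable (fun w => ∫ θ, logOneAdd (h (S (m + 1) (Function.update w m θ)))
          ∂AddCircle.haarAddCircle) torusMeasure :=
        (integrable_of_continuous ((hh.continuous_logOneAdd_comp (hSc _) (hSK _)).comp
          (continuous_fst.update m continuous_snd))).integral_prod_left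
      refine integral_mono (integrable_of_continuous
        (hh.continuous_logOneAdd_comp (hSc m) (hSK m))) (hi.const_mul _) fun w => ?_
      have := logOneAdd_le_integral (hh.diffContOnCl (hSK m w) m) (hz m)
      simp only [e1]
      have h1 : S m w m = z m := by simp [S]
      have e2 : Function.update (S m w) m (z m) = S m w := by rw [← h1, Function.update_eq_self]
      rw [e2] at this
      exact this
  have hlim := hh.tendsto_integral hSc hSK (g := torusPoint) torusPoint_mem fun w j => by
    filter_upwards [eventually_gt_atTop j] with m hm
    simp [S, hm]
  refine ge_of_tendsto' (hlim.const_mul C) fun m => (hstep m).trans ?_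
  exact mul_le_mul_of_nonneg_right (hC m) (integral_nonneg fun w => logOneAdd_nonneg _)

end InPolydiscAlgebra

/-! ### Monomials and Dirichlet polynomials -/

/-- The monomial `z^{α(n)}`, for sequences `z` in a commutative monoid. -/
noncomputable def monomial {R : Type*} [CommMonoid R] (n : ℕ) (z : ℕ → R) : R :=
  n.factorization.prod fun p k => z (Nat.primeCounting' p) ^ k

section monomial

variable {R : Type*} [CommMonoid R]

theorem monomial_mul_left {m n : ℕ} (hm : m ≠ 0) (hn : n ≠ 0) (z : ℕ → R) :
    monomial (m * n) z = monomial m z * monomial n z := by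
  unfold monomial
  rw [Nat.factorization_mul hm hn, Finsupp.prod_add_index']
  · simp
  · intro p k l; exact pow_add _ _ _

@[simp]
theorem monomial_one (z : ℕ → R) : monomial 1 z = 1 := by simp [monomial]

theorem monomial_prime {p : ℕ} (hp : p.Prime) (z : ℕ → R) :
    monomial p z = z (Nat.primeCounting' p) := by
  simp [monomial, hp.factorization]

theorem monomial_mul (n : ℕ) (x y : ℕ → R) :
    monomial n (fun j => x j * y j) = monomial n x * monomial n y := by
  simp [monomial, mul_pow, Finsupp.prod, Finset.prod_mul_distrib]

theorem map_monomial {S F : Type*} [CommMonoid S] [FunLike F R S] [MonoidHomClass F R S] (f : F)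
    (n : ℕ) (z : ℕ → R) : f (monomial n z) = monomial n fun j => f (z j) := by
  simp [monomial, Finsupp.prod, map_prod]

/-- The monomial of `n` involves only the coordinates of index at most `n`. -/
theorem monomial_congr {n : ℕ} {x y : ℕ → R} (h : ∀ j ≤ n, x j = y j) :
    monomial n x = monomial n y := by
  unfold monomial Finsupp.prod
  refine Finset.prod_congr rfl fun p hp => ?_
  have h1 : Nat.primeCounting' p ≤ n := (Nat.count_le (p := Nat.Prime) (n := p)).trans
    (Nat.le_of_mem_primeFactors hp)
  simp only [h _ h1]

end monomial

theorem norm_monomial (n : ℕ) (z : ℕ → ℂ) : ‖monomial n z‖ = monomial n fun j => ‖z j‖ :=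
  map_monomial (normHom (α := ℂ)) n z

theorem monomial_nonneg (n : ℕ) {x : ℕ → ℝ} (hx : ∀ j, 0 ≤ x j) : 0 ≤ monomial n x := by
  unfold monomial Finsupp.prod
  exact Finset.prod_nonneg fun _ _ => pow_nonneg (hx _) _

theorem monomial_mono (n : ℕ) {x y : ℕ → ℝ} (hx : ∀ j, 0 ≤ x j) (hxy : ∀ j, x j ≤ y j) :
    monomial n x ≤ monomial n y := by
  unfold monomial Finsupp.prod
  exact Finset.prod_le_prod (fun _ _ => pow_nonneg (hx _) _)
    fun _ _ => pow_le_pow_left₀ (hx _) (hxy _) _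

theorem continuous_monomial (n : ℕ) : Continuous (monomial n : (ℕ → ℂ) → ℂ) := by
  unfold monomial Finsupp.prod
  fun_prop

theorem norm_monomial_torusPoint (n : ℕ) (w : ℕ → UnitAddCircle) :
    ‖monomial n (torusPoint w)‖ = 1 := by
  rw [norm_monomial]
  simp [torusPoint, monomial]

theorem monomial_torusPoint_add (n : ℕ) (v w : ℕ → UnitAddCircle) :
    monomial n (torusPoint (v + w)) = monomial n (torusPoint v) * monomial n (torusPoint w) := by
  rw [← monomial_mul]
  congr 1
  funext j
  exact expCircle_add _ _

/-- The `j`-th prime number, indexed from `0`. -/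
noncomputable abbrev prime (j : ℕ) : ℕ := Nat.nth Nat.Prime j

theorem prime_prime (j : ℕ) : (prime j).Prime := Nat.prime_nth_prime j

theorem primeCounting'_prime (j : ℕ) : Nat.primeCounting' (prime j) = j :=
  Nat.primeCounting'_nth_eq j

theorem prime_primeCounting' {p : ℕ} (hp : p.Prime) : prime (Nat.primeCounting' p) = p :=
  Nat.nth_count hp

theorem monomial_prime_cpow {n : ℕ} (hn : n ≠ 0) (s : ℂ) :
    monomial n (fun j => (prime j : ℂ) ^ (-s)) = (n : ℂ) ^ (-s) := by
  induction n using induction_on_primes with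
  | zero => exact absurd rfl hn
  | one => simp
  | prime_mul p a hp ih =>
    have ha : a ≠ 0 := right_ne_zero_of_mul hn
    rw [monomial_mul_left hp.ne_zero ha, ih ha, monomial_prime hp, prime_primeCounting' hp,
      Nat.cast_mul, Complex.natCast_mul_natCast_cpow]

/-- The radii `p_j^{-σ}`. -/
noncomputable def primeRadius (σ : ℝ) (j : ℕ) : ℝ := (prime j : ℝ) ^ (-σ)

theorem primeRadius_pos (σ : ℝ) (j : ℕ) : 0 < primeRadius σ j :=
  Real.rpow_pos_of_pos (by exact_mod_cast (prime_prime j).pos) _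

/-- The Kronecker flow `t ↦ (p_j^{-it})_j` on the torus. -/
noncomputable def kroneckerFlow (t : ℝ) (j : ℕ) : UnitAddCircle :=
  ((-(t * Real.log (prime j)) / (2 * Real.pi) : ℝ) : UnitAddCircle)

theorem continuous_kroneckerFlow : Continuous kroneckerFlow := by
  refine continuous_pi fun j => ?_
  exact (AddCircle.continuous_mk' (1 : ℝ)).comp (by fun_prop)

theorem torusPoint_kroneckerFlow (t : ℝ) :
    torusPoint (kroneckerFlow t) = fun j => (prime j : ℂ) ^ (-(t * Complex.I)) := by
  funext j
  have hp : (prime j : ℂ) ≠ 0 := by exact_mod_cast (prime_prime j).ne_zero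
  rw [torusPoint, kroneckerFlow, expCircle, AddCircle.toCircle_apply_mk, Circle.coe_exp,
    Complex.cpow_def_of_ne_zero hp, ← Complex.natCast_log]
  congr 1
  push_cast
  field_simp

theorem monomial_kroneckerFlow {n : ℕ} (hn : n ≠ 0) (t : ℝ) :
    monomial n (torusPoint (kroneckerFlow t)) = (n : ℂ) ^ (-(t * Complex.I)) := by
  rw [torusPoint_kroneckerFlow, monomial_prime_cpow hn]

/-- The polynomial `∑_{n=1}^N a_n z^{α(n)}`. -/
noncomputable def bohrPoly (a : ArithmeticFunction ℂ) (N : ℕ) (z : ℕ → ℂ) : ℂ :=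
  ∑ n ∈ Finset.Icc 1 N, a n * monomial n z

theorem continuous_bohrPoly (a : ArithmeticFunction ℂ) (N : ℕ) : Continuous (bohrPoly a N) := by
  unfold bohrPoly
  have := continuous_monomial
  fun_prop

theorem partialSum_eq_bohrPoly (a : ArithmeticFunction ℂ) (N : ℕ) (σ t : ℝ) :
    partialSum a N ((σ : ℂ) + t * Complex.I) =
      bohrPoly a N fun j => primeRadius σ j * torusPoint (kroneckerFlow t) j := by
  refine Finset.sum_congr rfl fun n hn => ?_
  have hn0 : n ≠ 0 := by have := (Finset.mem_Icc.1 hn).1; omega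
  rw [← monomial_prime_cpow hn0, torusPoint_kroneckerFlow]
  congr 2
  funext j
  have hp : (prime j : ℂ) ≠ 0 := by exact_mod_cast (prime_prime j).ne_zero
  rw [neg_add, Complex.cpow_add _ _ hp, primeRadius, Complex.ofReal_cpow (by positivity)]
  simp

/-! ### Equidistribution of the Kronecker flow -/

/-- The character `w ↦ w^{α(m)} \overline{w^{α(n)}}` of the torus. -/
noncomputable def torusChar (m n : ℕ) : C(ℕ → UnitAddCircle, ℂ) where
  toFun w := monomial m (torusPoint w) * star (monomial n (torusPoint w))
  continuous_toFun := by
    have := fun n => (continuous_monomial n).comp continuous_torusPoint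
    exact (this m).mul (this n).star

theorem torusChar_self (n : ℕ) (w : ℕ → UnitAddCircle) : torusChar n n w = 1 := by
  simp [torusChar, Complex.mul_conj, Complex.normSq_eq_norm_sq, norm_monomial_torusPoint]

theorem torusChar_add (m n : ℕ) (v w : ℕ → UnitAddCircle) :
    torusChar m n (v + w) = torusChar m n v * torusChar m n w := by
  simp only [torusChar, ContinuousMap.coe_mk, monomial_torusPoint_add, star_mul']
  ring

theorem torusChar_kroneckerFlow {m n : ℕ} (hm : m ≠ 0) (hn : n ≠ 0) (t : ℝ) :
    torusChar m n (kroneckerFlow t) =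
      Complex.exp (((Real.log n - Real.log m : ℝ) * Complex.I) * t) := by
  have h : ∀ k : ℕ, k ≠ 0 → monomial k (torusPoint (kroneckerFlow t)) =
      Complex.exp (-(Real.log k * Complex.I * t)) := fun k hk => by
    rw [monomial_kroneckerFlow hk, Complex.cpow_def_of_ne_zero (by exact_mod_cast hk),
      ← Complex.natCast_log]
    congr 1
    ring
  simp only [torusChar, ContinuousMap.coe_mk, h m hm, h n hn]
  rw [Complex.star_def, ← Complex.exp_conj, ← Complex.exp_add]
  congr 1
  simp only [map_neg, map_mul, Complex.conj_ofReal, Complex.conj_I]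
  push_cast
  ring

theorem log_sub_log_ne_zero {m n : ℕ} (hm : m ≠ 0) (hn : n ≠ 0) (hmn : m ≠ n) :
    Real.log n - Real.log m ≠ 0 := by
  rw [sub_ne_zero]
  intro h
  have := Real.log_injOn_pos (show (0 : ℝ) < n by positivity) (show (0 : ℝ) < m by positivity) h
  exact hmn (by exact_mod_cast this.symm)

theorem integral_torusChar {m n : ℕ} (hm : m ≠ 0) (hn : n ≠ 0) :
    ∫ w, torusChar m n w ∂torusMeasure = if m = n then 1 else 0 := by
  split_ifs with hmn
  · subst hmn
    simp [torusChar_self]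
  · -- a translation by a point of the flow multiplies the integral by a number different from `1`
    have hl := log_sub_log_ne_zero hm hn hmn
    have h := (measurePreserving_add_right
      (kroneckerFlow (Real.pi / (Real.log n - Real.log m)))).integral_comp
      (Homeomorph.addRight _).measurableEmbedding (torusChar m n)
    simp only [torusChar_add, torusChar_kroneckerFlow hm hn] at h
    rw [integral_mul_const] at h
    have he : Complex.exp (((Real.log n - Real.log m : ℝ) * Complex.I) *
        ((Real.pi / (Real.log n - Real.log m) : ℝ) : ℂ)) = -1 := by
      rw [← Complex.exp_pi_mul_I]
      congr 1
      have : ((Real.log n - Real.log m : ℝ) : ℂ) ≠ 0 := by exact_mod_cast hl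
      rw [Complex.ofReal_div]
      field_simp
    rw [he] at h
    linear_combination -h / 2

/-- The mean of `G` over the segment `[-T, T]` of the Kronecker flow. -/
noncomputable def flowMean (G : C(ℕ → UnitAddCircle, ℂ)) (T : ℝ) : ℂ :=
  ((2 * T)⁻¹ : ℝ) • ∫ t in (-T)..T, G (kroneckerFlow t)

theorem continuous_comp_kroneckerFlow (G : C(ℕ → UnitAddCircle, ℂ)) :
    Continuous fun t => G (kroneckerFlow t) := G.continuous.comp continuous_kroneckerFlow

theorem flowMean_add (F G : C(ℕ → UnitAddCircle, ℂ)) (T : ℝ) :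
    flowMean (F + G) T = flowMean F T + flowMean G T := by
  simp only [flowMean, ContinuousMap.add_apply]
  rw [intervalIntegral.integral_add ((continuous_comp_kroneckerFlow F).intervalIntegrable _ _)
    ((continuous_comp_kroneckerFlow G).intervalIntegrable _ _), smul_add]

theorem flowMean_smul (c : ℂ) (G : C(ℕ → UnitAddCircle, ℂ)) (T : ℝ) :
    flowMean (c • G) T = c • flowMean G T := by
  simp only [flowMean, ContinuousMap.smul_apply]
  rw [intervalIntegral.integral_smul, smul_comm]

theorem norm_flowMean_le (G : C(ℕ → UnitAddCircle, ℂ)) {T : ℝ} (hT : 0 < T) :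
    ‖flowMean G T‖ ≤ ‖G‖ := by
  have h := intervalIntegral.norm_integral_le_of_norm_le_const (a := -T) (b := T)
    (f := fun t => G (kroneckerFlow t)) (C := ‖G‖) fun t _ => G.norm_coe_le_norm _
  have h2 : |T - -T| = 2 * T := by rw [abs_of_pos (by linarith)]; ring
  rw [h2] at h
  rw [flowMean, norm_smul, Real.norm_of_nonneg (by positivity), inv_mul_le_iff₀ (by positivity)]
  linarith

theorem tendsto_flowMean_torusChar {m n : ℕ} (hm : m ≠ 0) (hn : n ≠ 0) :
    Tendsto (flowMean (torusChar m n)) atTop (𝓝 (∫ w, torusChar m n w ∂torusMeasure)) := by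
  rw [integral_torusChar hm hn]
  split_ifs with hmn
  · subst hmn
    refine tendsto_const_nhds.congr' ?_
    filter_upwards [eventually_gt_atTop 0] with T hT
    simp only [flowMean, torusChar_self, intervalIntegral.integral_const]
    rw [smul_smul, sub_neg_eq_add, ← two_mul, inv_mul_cancel₀ (by positivity), one_smul]
  · have hl := log_sub_log_ne_zero hm hn hmn
    set l : ℝ := Real.log n - Real.log m
    have hl' : (l : ℂ) * Complex.I ≠ 0 := by simp [hl]
    have hb : ∀ T : ℝ, 0 < T → ‖flowMean (torusChar m n) T‖ ≤ (2 * T)⁻¹ * (2 / |l|) := by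
      intro T hT
      simp only [flowMean, torusChar_kroneckerFlow hm hn]
      rw [integral_exp_mul_complex hl', norm_smul, Real.norm_of_nonneg (by positivity)]
      refine mul_le_mul_of_nonneg_left ?_ (by positivity)
      rw [norm_div, norm_mul, Complex.norm_I, mul_one, Complex.norm_real, Real.norm_eq_abs]
      refine div_le_div_of_nonneg_right ((norm_sub_le _ _).trans ?_) (abs_nonneg _)
      have he : ∀ x : ℝ, ‖Complex.exp ((l : ℂ) * Complex.I * x)‖ = 1 := fun x => by
        simp [Complex.norm_exp]
      have := he T
      have h2 := he (-T)
      rw [this, h2]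
      norm_num
    refine squeeze_zero_norm' (a := fun T => (2 * T)⁻¹ * (2 / |l|)) ?_ ?_
    · filter_upwards [eventually_gt_atTop 0] with T hT using hb T hT
    · have : Tendsto (fun T : ℝ => (2 * T)⁻¹) atTop (𝓝 0) :=
        tendsto_inv_atTop_zero.comp (tendsto_id.const_mul_atTop two_pos)
      simpa using this.mul_const (2 / |l|)

/-- The characters `torusChar m n` with `m, n ≠ 0` form a monoid. -/
noncomputable def torusCharMonoid : Submonoid C(ℕ → UnitAddCircle, ℂ) where
  carrier := {G | ∃ m n : ℕ, m ≠ 0 ∧ n ≠ 0 ∧ G = torusChar m n}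
  one_mem' := ⟨1, 1, one_ne_zero, one_ne_zero, by ext w; simp [torusChar]⟩
  mul_mem' := by
    rintro _ _ ⟨m, n, hm, hn, rfl⟩ ⟨m', n', hm', hn', rfl⟩
    refine ⟨m * m', n * n', mul_ne_zero hm hm', mul_ne_zero hn hn', ?_⟩
    ext w
    simp only [torusChar, ContinuousMap.mul_apply, ContinuousMap.coe_mk,
      monomial_mul_left hm hm', monomial_mul_left hn hn', star_mul']
    ring

theorem topologicalClosure_adjoin_torusChar :
    (Algebra.adjoin ℂ (torusCharMonoid : Set C(ℕ → UnitAddCircle, ℂ))).topologicalClosure = ⊤ := by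
  let A : StarSubalgebra ℂ C(ℕ → UnitAddCircle, ℂ) :=
    { Algebra.adjoin ℂ (torusCharMonoid : Set C(ℕ → UnitAddCircle, ℂ)) with
      star_mem' := by
        intro G hG
        change G ∈ Algebra.adjoin ℂ _ at hG
        change star G ∈ Algebra.adjoin ℂ _
        induction hG using Algebra.adjoin_induction with
        | mem G hG =>
          obtain ⟨m, n, hm, hn, rfl⟩ := hG
          refine Algebra.subset_adjoin ⟨n, m, hn, hm, ?_⟩
          ext w
          simp [torusChar, mul_comm]
        | algebraMap c =>
          rw [← algebraMap_star_comm]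
          exact Subalgebra.algebraMap_mem _ _
        | add F G _ _ hF hG => rw [star_add]; exact add_mem hF hG
        | mul F G _ _ hF hG => rw [star_mul]; exact mul_mem hG hF }
  have hsep : A.toSubalgebra.SeparatesPoints := by
    intro v w hvw
    obtain ⟨j, hj⟩ := Function.ne_iff.1 hvw
    refine ⟨torusChar (prime j) 1, ⟨torusChar (prime j) 1, Algebra.subset_adjoin
      ⟨_, 1, (prime_prime j).ne_zero, one_ne_zero, rfl⟩, rfl⟩, ?_⟩
    simp only [torusChar, ContinuousMap.coe_mk, monomial_one, star_one, mul_one,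
      monomial_prime (prime_prime j), primeCounting'_prime]
    exact fun h => hj (AddCircle.injective_toCircle one_ne_zero (Subtype.ext h))
  have h := ContinuousMap.starSubalgebra_topologicalClosure_eq_top_of_separatesPoints A hsep
  ext G
  simp only [Algebra.mem_top, iff_true]
  have hG : G ∈ A.topologicalClosure := h ▸ StarSubalgebra.mem_top
  exact hG

/-- **Kronecker–Weyl**: the Kronecker flow is equidistributed in the torus. -/
theorem tendsto_flowMean (G : C(ℕ → UnitAddCircle, ℂ)) :
    Tendsto (flowMean G) atTop (𝓝 (∫ w, G w ∂torusMeasure)) := by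
  have hint : ∀ F : C(ℕ → UnitAddCircle, ℂ), Integrable F torusMeasure := fun F =>
    integrable_of_continuous F.continuous
  have hspan : ∀ P ∈ Submodule.span ℂ (torusCharMonoid : Set C(ℕ → UnitAddCircle, ℂ)),
      Tendsto (flowMean P) atTop (𝓝 (∫ w, P w ∂torusMeasure)) := by
    intro P hP
    induction hP using Submodule.span_induction with
    | mem P hP =>
      obtain ⟨m, n, hm, hn, rfl⟩ := hP
      exact tendsto_flowMean_torusChar hm hn
    | zero =>
      have : flowMean 0 = fun _ => 0 := by funext T; simp [flowMean]
      simp [this]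
    | add F G _ _ hF hG =>
      have h1 : flowMean (F + G) = fun T => flowMean F T + flowMean G T :=
        funext fun T => flowMean_add F G T
      have h2 : ∫ w, (F + G) w ∂torusMeasure = (∫ w, F w ∂torusMeasure) + ∫ w, G w ∂torusMeasure :=
        integral_add (hint F) (hint G)
      rw [h1, h2]
      exact hF.add hG
    | smul c F _ hF =>
      have h1 : flowMean (c • F) = fun T => c • flowMean F T := funext fun T => flowMean_smul c F T
      have h2 : ∫ w, (c • F) w ∂torusMeasure = c • ∫ w, F w ∂torusMeasure := integral_smul c _
      rw [h1, h2]
      exact hF.const_smul c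
  rw [Metric.tendsto_nhds]
  intro ε hε
  have hG : G ∈ closure (Algebra.adjoin ℂ
      (torusCharMonoid : Set C(ℕ → UnitAddCircle, ℂ)) : Set C(ℕ → UnitAddCircle, ℂ)) := by
    rw [← Subalgebra.topologicalClosure_coe, topologicalClosure_adjoin_torusChar]
    trivial
  obtain ⟨P, hP, hPG⟩ := Metric.mem_closure_iff.1 hG (ε / 3) (by positivity)
  have hP' : P ∈ Submodule.span ℂ (torusCharMonoid : Set C(ℕ → UnitAddCircle, ℂ)) := by
    have h1 : P ∈ Subalgebra.toSubmodule (Algebra.adjoin ℂ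
      (torusCharMonoid : Set C(ℕ → UnitAddCircle, ℂ))) := hP
    rwa [Algebra.adjoin_eq_span, Submonoid.closure_eq] at h1
  rw [dist_eq_norm] at hPG
  filter_upwards [Metric.tendsto_nhds.1 (hspan P hP') (ε / 3) (by positivity),
    eventually_gt_atTop 0] with T hT hT0
  have e1 : flowMean G T = flowMean (G - P) T + flowMean P T := by
    rw [← flowMean_add, sub_add_cancel]
  have e2 : ∫ w, G w ∂torusMeasure = (∫ w, (G - P) w ∂torusMeasure) + ∫ w, P w ∂torusMeasure := by
    rw [← integral_add (hint _) (hint _)]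
    simp
  have h1 := norm_flowMean_le (G - P) hT0
  have h2 : ‖∫ w, (G - P) w ∂torusMeasure‖ ≤ ‖G - P‖ := by
    have := norm_integral_le_of_norm_le_const (μ := torusMeasure) (f := G - P) (C := ‖G - P‖)
      (Eventually.of_forall fun w => (G - P).norm_coe_le_norm w)
    simpa using this
  rw [dist_eq_norm] at hT ⊢
  rw [e1, e2, add_sub_add_comm]
  refine (norm_add_le _ _).trans_lt ?_
  have := norm_sub_le (flowMean (G - P) T) (∫ w, (G - P) w ∂torusMeasure)
  linarith

theorem tendsto_flowMean_real {g : (ℕ → UnitAddCircle) → ℝ} (hg : Continuous g) :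
    Tendsto (fun T : ℝ => (2 * T)⁻¹ * ∫ t in (-T)..T, g (kroneckerFlow t)) atTop
      (𝓝 (∫ w, g w ∂torusMeasure)) := by
  have h := (Complex.continuous_re.tendsto _).comp (tendsto_flowMean
    ⟨fun w => (g w : ℂ), Complex.continuous_ofReal.comp hg⟩)
  simp only [ContinuousMap.coe_mk, integral_complex_ofReal, Complex.ofReal_re] at h
  refine h.congr fun T => ?_
  simp [flowMean, intervalIntegral.integral_ofReal]

/-- A continuous function on the torus which is bounded above on the Kronecker flow is bounded above
everywhere by the same bound. -/
theorem le_of_forall_kroneckerFlow_le {g : (ℕ → UnitAddCircle) → ℝ} (hg : Continuous g) {c : ℝ}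
    (hc : ∀ t, g (kroneckerFlow t) ≤ c) (w : ℕ → UnitAddCircle) : g w ≤ c := by
  have hm : Continuous fun w => max (g w - c) 0 := by fun_prop
  have h0 : ∀ t, max (g (kroneckerFlow t) - c) 0 = 0 := fun t =>
    max_eq_right (by linarith [hc t])
  have h := tendsto_flowMean_real hm
  simp only [h0, intervalIntegral.integral_zero, mul_zero] at h
  have h1 := tendsto_nhds_unique tendsto_const_nhds h
  have h2 := (integral_eq_zero_iff_of_nonneg (fun w => le_max_right _ _)
    (integrable_of_continuous hm)).1 h1.symm
  have h3 := congr_fun ((Continuous.ae_eq_iff_eq torusMeasure hm continuous_zero).1 h2) w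
  have h4 := le_max_left (g w - c) 0
  simp only [Pi.zero_apply] at h3
  linarith

/-! ### The boundary function of a Dirichlet series on a vertical line -/

/-- The function `w ↦ ∑_{n=1}^N a_n n^{-σ} w^{α(n)}` on the torus. -/
noncomputable def linePoly (a : ArithmeticFunction ℂ) (σ : ℝ) (N : ℕ) :
    C(ℕ → UnitAddCircle, ℂ) where
  toFun w := bohrPoly a N fun j => primeRadius σ j * torusPoint w j
  continuous_toFun := by
    refine (continuous_bohrPoly a N).comp (continuous_pi fun j => ?_)
    have : Continuous fun w => torusPoint w j := (continuous_apply j).comp continuous_torusPoint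
    fun_prop

/-- By the density of the Kronecker flow, uniform convergence of the Dirichlet series on the line of
abscissa `σ` gives uniform convergence on the torus. -/
theorem exists_tendsto_linePoly {a : ArithmeticFunction ℂ} (ha : abscissaUnif a ≤ 0) {σ : ℝ}
    (hσ : 0 < σ) :
    ∃ G : C(ℕ → UnitAddCircle, ℂ), Tendsto (linePoly a σ) atTop (𝓝 G) ∧
      ∀ t : ℝ, dirichletSum a ((σ : ℂ) + t * Complex.I) = G (kroneckerFlow t) := by
  obtain ⟨g, hg⟩ := convergesUniformlyOn_of_pos ha (half_pos hσ)
  have hcauchy : CauchySeq (linePoly a σ) := by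
    rw [Metric.cauchySeq_iff]
    intro ε hε
    obtain ⟨N, hN⟩ := Metric.uniformCauchySeqOn_iff.1 hg.uniformCauchySeqOn (ε / 2) (half_pos hε)
    refine ⟨N, fun m hm n hn => lt_of_le_of_lt ?_ (half_lt_self hε)⟩
    rw [ContinuousMap.dist_le (half_pos hε).le]
    refine le_of_forall_kroneckerFlow_le (by fun_prop) fun t => ?_
    have h := hN m hm n hn ((σ : ℂ) + t * Complex.I)
      (by simp only [mem_ofPred_eq]; simp; linarith)
    rw [partialSum_eq_bohrPoly, partialSum_eq_bohrPoly] at h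
    exact h.le
  obtain ⟨G, hG⟩ := cauchySeq_tendsto_of_complete hcauchy
  refine ⟨G, hG, fun t => tendsto_nhds_unique (tendsto_dirichletSum ha (by simpa using hσ)) ?_⟩
  simp only [partialSum_eq_bohrPoly]
  exact ((ContinuousEvalConst.continuous_eval_const (kroneckerFlow t)).tendsto G).comp hG

theorem tendsto_verticalMean {a : ArithmeticFunction ℂ} {σ : ℝ} {G : C(ℕ → UnitAddCircle, ℂ)}
    (hG : ∀ t : ℝ, dirichletSum a ((σ : ℂ) + t * Complex.I) = G (kroneckerFlow t)) :
    Tendsto (fun T : ℝ => verticalMean a σ T) atTop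
      (𝓝 (ENNReal.ofReal (∫ w, logOneAdd (G w) ∂torusMeasure))) := by
  have hc : Continuous fun w => logOneAdd (G w) := continuous_logOneAdd.comp G.continuous
  refine ((ENNReal.continuous_ofReal.tendsto _).comp (tendsto_flowMean_real hc)).congr' ?_
  filter_upwards [eventually_gt_atTop 0] with T hT
  have hcf : Continuous fun t => logOneAdd (G (kroneckerFlow t)) :=
    hc.comp continuous_kroneckerFlow
  simp only [verticalMean, hG, Function.comp_apply]
  rw [← div_eq_inv_mul, ENNReal.ofReal_div_of_pos (by positivity),
    intervalIntegral.integral_of_le (by linarith), ← integral_Icc_eq_integral_Ioc,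
    ofReal_integral_eq_lintegral_ofReal (hcf.integrableOn_Icc)
      (Eventually.of_forall fun t => logOneAdd_nonneg _)]
  rfl

theorem lineNorm_eq {a : ArithmeticFunction ℂ} {σ : ℝ} {G : C(ℕ → UnitAddCircle, ℂ)}
    (hG : ∀ t : ℝ, dirichletSum a ((σ : ℂ) + t * Complex.I) = G (kroneckerFlow t)) :
    lineNorm a σ = ENNReal.ofReal (∫ w, logOneAdd (G w) ∂torusMeasure) :=
  (tendsto_verticalMean hG).limsup_eq

theorem tendsto_integral_logOneAdd {F : ℕ → C(ℕ → UnitAddCircle, ℂ)}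
    {G : C(ℕ → UnitAddCircle, ℂ)} (h : Tendsto F atTop (𝓝 G)) :
    Tendsto (fun N => ∫ w, logOneAdd (F N w) ∂torusMeasure) atTop
      (𝓝 (∫ w, logOneAdd (G w) ∂torusMeasure)) := by
  obtain ⟨C, hC⟩ := isBounded_iff_forall_norm_le.1 (Metric.isBounded_range_of_tendsto F h)
  refine tendsto_integral_of_dominated_convergence (fun _ => C)
    (fun N => (continuous_logOneAdd.comp (F N).continuous).aestronglyMeasurable)
    (integrable_const _) (fun N => Eventually.of_forall fun w => ?_)
    (Eventually.of_forall fun w => ?_)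
  · rw [Real.norm_of_nonneg (logOneAdd_nonneg _)]
    exact (logOneAdd_le_norm _).trans (((F N).norm_coe_le_norm w).trans (hC _ (mem_range_self N)))
  · exact (continuous_logOneAdd.tendsto _).comp
      (((ContinuousEvalConst.continuous_eval_const w).tendsto G).comp h)

/-! ### Summation of monomial series near a point of `ℓ¹` -/

/-- The exponent `α_j(n)` of the `j`-th prime in `n`. -/
noncomputable def primeExponent (n j : ℕ) : ℕ := n.factorization (prime j)

theorem monomial_eq_prod_range {R : Type*} [CommMonoid R] {n J : ℕ} (hn : n < J) (z : ℕ → R) :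
    monomial n z = ∏ j ∈ Finset.range J, z j ^ primeExponent n j := by
  unfold monomial Finsupp.prod
  refine Finset.prod_of_injOn Nat.primeCounting' ?_ ?_ ?_ ?_
  · intro p hp q hq hpq
    rw [← prime_primeCounting' (Nat.prime_of_mem_primeFactors hp),
      ← prime_primeCounting' (Nat.prime_of_mem_primeFactors hq), hpq]
  · intro p hp
    have h1 : Nat.primeCounting' p ≤ n := (Nat.count_le (p := Nat.Prime) (n := p)).trans
      (Nat.le_of_mem_primeFactors hp)
    simpa using h1.trans_lt hn
  · intro j _ hj
    have : n.factorization (prime j) = 0 := by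
      by_contra h
      exact hj ⟨prime j, Finsupp.mem_support_iff.2 h, primeCounting'_prime j⟩
    simp [primeExponent, this]
  · intro p hp
    simp only [primeExponent]
    rw [prime_primeCounting' (Nat.prime_of_mem_primeFactors hp)]

theorem eq_of_primeExponent_eq {m n J : ℕ} (hm0 : m ≠ 0) (hn0 : n ≠ 0) (hm : m < J) (hn : n < J)
    (h : ∀ j < J, primeExponent m j = primeExponent n j) : m = n := by
  have key : ∀ n : ℕ, n ≠ 0 → monomial n prime = n := fun n hn => by
    conv_rhs => rw [← Nat.prod_factorization_pow_eq_self hn]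
    unfold monomial Finsupp.prod
    refine Finset.prod_congr rfl fun p hp => ?_
    simp only [prime_primeCounting' (Nat.prime_of_mem_primeFactors hp)]
  rw [← key m hm0, ← key n hn0, monomial_eq_prod_range hm, monomial_eq_prod_range hn]
  exact Finset.prod_congr rfl fun j hj => by rw [h j (Finset.mem_range.1 hj)]

/-- The multinomial coefficient of `β` is at least `e^{-m} m^m / ∏ β_j^{β_j}`, where `m = ∑ β_j`. -/
theorem one_le_prod_mul_exp_mul_multinomial (s : Finset ℕ) (β : ℕ → ℕ) :
    (1 : ℝ) ≤ (∏ j ∈ s, ((β j : ℝ) / (∑ i ∈ s, β i : ℕ)) ^ β j) *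
      (Real.exp (∑ i ∈ s, β i : ℕ) * Nat.multinomial s β) := by
  set m := ∑ i ∈ s, β i with hm
  have h1 : ∏ j ∈ s, ((β j : ℝ) / m) ^ β j = (∏ j ∈ s, (β j : ℝ) ^ β j) / (m : ℝ) ^ m := by
    simp_rw [div_pow]
    rw [Finset.prod_div_distrib, Finset.prod_pow_eq_pow_sum]
  have hspec : ((∏ i ∈ s, (β i).factorial : ℕ) : ℝ) * Nat.multinomial s β = (m.factorial : ℝ) := by
    exact_mod_cast Nat.multinomial_spec s β
  have hfac : ((∏ i ∈ s, (β i).factorial : ℕ) : ℝ) ≤ ∏ j ∈ s, (β j : ℝ) ^ β j := by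
    exact_mod_cast Finset.prod_le_prod' fun i _ => Nat.factorial_le_pow (β i)
  have hpow : (0 : ℝ) < (m : ℝ) ^ m := by
    rcases Nat.eq_zero_or_pos m with h | h
    · simp [h]
    · positivity
  have hexp := Real.pow_div_factorial_le_exp (m : ℝ) (by positivity) m
  rw [div_le_iff₀ (by positivity)] at hexp
  rw [h1, div_mul_eq_mul_div, le_div_iff₀ hpow, one_mul]
  calc (m : ℝ) ^ m ≤ Real.exp m * m.factorial := hexp
    _ = ((∏ i ∈ s, (β i).factorial : ℕ) : ℝ) * (Real.exp m * Nat.multinomial s β) := by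
        rw [← hspec]; ring
    _ ≤ _ := mul_le_mul_of_nonneg_right hfac (by positivity)

/-- A bound, independent of `N`, of the sum over the multi-indices `α(n)` for `n ≤ N` of geometric
weights in the indices `j < k` times multinomial weights in the indices `j ≥ k`. -/
theorem sum_geometric_mul_multinomial_le (k N J : ℕ) (hN : N < J) {q : ℝ}
    (hq : q ∈ Ico (0 : ℝ) 1) {y : ℕ → ℝ} (hy : ∀ j, 0 ≤ y j)
    (hy' : ∑ j ∈ Finset.Ico k J, y j ≤ 1 / 2) :
    ∑ n ∈ Finset.Icc 1 N, (∏ j ∈ Finset.range k, q ^ primeExponent n j) *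
      (Nat.multinomial (Finset.Ico k J) (primeExponent n) *
        ∏ j ∈ Finset.Ico k J, y j ^ primeExponent n j) ≤ (1 - q)⁻¹ ^ k * 2 := by
  classical
  let L : ℕ := ∑ n ∈ Finset.Icc 1 N, ∑ j ∈ Finset.Ico k J, primeExponent n j
  let A : Finset (Fin k → ℕ) := Fintype.piFinset fun _ => Finset.range (N + 1)
  let B : Finset (Σ _ : ℕ, ℕ → ℕ) :=
    (Finset.range (L + 1)).sigma fun m => Finset.piAntidiag (Finset.Ico k J) m
  let tail : ℕ → ℕ → ℕ := fun n j => if j ∈ Finset.Ico k J then primeExponent n j else 0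
  let e : ℕ → (Fin k → ℕ) × (Σ _ : ℕ, ℕ → ℕ) := fun n =>
    (fun i => primeExponent n i, ⟨∑ j ∈ Finset.Ico k J, primeExponent n j, tail n⟩)
  let W : (Fin k → ℕ) × (Σ _ : ℕ, ℕ → ℕ) → ℝ := fun x => (∏ i, q ^ x.1 i) *
    (Nat.multinomial (Finset.Ico k J) x.2.2 * ∏ j ∈ Finset.Ico k J, y j ^ x.2.2 j)
  have htail : ∀ n, ∀ j ∈ Finset.Ico k J, tail n j = primeExponent n j := fun n j hj => if_pos hj
  have he : Set.InjOn e (Finset.Icc 1 N) := by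
    intro m hm n hn hmn
    have hm' := Finset.mem_Icc.1 (Finset.mem_coe.1 hm)
    have hn' := Finset.mem_Icc.1 (Finset.mem_coe.1 hn)
    obtain ⟨h1, h2⟩ := Prod.ext_iff.1 hmn
    have h3 : tail m = tail n := eq_of_heq (Sigma.ext_iff.1 h2).2
    refine eq_of_primeExponent_eq (J := J) (by omega) (by omega) (by omega) (by omega)
      fun j hj => ?_
    by_cases hjk : j < k
    · exact congr_fun h1 ⟨j, hjk⟩
    · have hj' : j ∈ Finset.Ico k J := Finset.mem_Ico.2 ⟨not_lt.1 hjk, hj⟩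
      rw [← htail m j hj', ← htail n j hj', h3]
  have hmaps : ∀ n ∈ Finset.Icc 1 N, e n ∈ A ×ˢ B := by
    intro n hn
    have hn' := Finset.mem_Icc.1 hn
    rw [Finset.mem_product, Fintype.mem_piFinset, Finset.mem_sigma]
    refine ⟨fun i => ?_, ?_, ?_⟩
    · have h1 : primeExponent n i < n := Nat.factorization_lt _ (by omega)
      exact Finset.mem_range.2 (by change primeExponent n i < _; omega)
    · exact Finset.mem_range.2 (Nat.lt_succ_of_le (Finset.single_le_sum
        (f := fun n => ∑ j ∈ Finset.Ico k J, primeExponent n j) (fun _ _ => Nat.zero_le _) hn))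
    · refine Finset.mem_piAntidiag.2 ⟨Finset.sum_congr rfl (htail n), fun j hj => ?_⟩
      by_contra h
      exact hj (if_neg h)
  have hW : ∀ x, 0 ≤ W x := fun x => mul_nonneg (Finset.prod_nonneg fun _ _ => pow_nonneg hq.1 _)
    (mul_nonneg (by positivity) (Finset.prod_nonneg fun j _ => pow_nonneg (hy j) _))
  have hA : ∑ x ∈ A, ∏ i, q ^ x i ≤ (1 - q)⁻¹ ^ k := by
    rw [← Finset.prod_univ_sum (fun _ => Finset.range (N + 1)) fun _ i => q ^ i]
    simp only [Finset.prod_const, Finset.card_univ, Fintype.card_fin]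
    refine pow_le_pow_left₀ (Finset.sum_nonneg fun _ _ => pow_nonneg hq.1 _) ?_ _
    rw [← tsum_geometric_of_lt_one hq.1 hq.2]
    exact (summable_geometric_of_lt_one hq.1 hq.2).sum_le_tsum _ fun _ _ => pow_nonneg hq.1 _
  have hB : ∑ x ∈ B, (Nat.multinomial (Finset.Ico k J) x.2 : ℝ) *
      ∏ j ∈ Finset.Ico k J, y j ^ x.2 j ≤ 2 := by
    rw [Finset.sum_sigma]
    simp only [← Finset.sum_pow_eq_sum_piAntidiag]
    calc _ ≤ ∑ m ∈ Finset.range (L + 1), (1 / 2 : ℝ) ^ m := Finset.sum_le_sum fun m _ =>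
          pow_le_pow_left₀ (Finset.sum_nonneg fun j _ => hy j) hy' _
      _ ≤ 2 := sum_geometric_two_le _
  calc _ = ∑ n ∈ Finset.Icc 1 N, W (e n) := by
        refine Finset.sum_congr rfl fun n _ => ?_
        simp only [W, e]
        rw [Finset.prod_range, Nat.multinomial_congr (htail n)]
        congr 2
        exact Finset.prod_congr rfl fun j hj => by rw [htail n j hj]
    _ = ∑ x ∈ (Finset.Icc 1 N).image e, W x := (Finset.sum_image he).symm
    _ ≤ ∑ x ∈ A ×ˢ B, W x := Finset.sum_le_sum_of_subset_of_nonneg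
        (Finset.image_subset_iff.2 hmaps) fun x _ _ => hW x
    _ = (∑ x ∈ A, ∏ i, q ^ x i) * ∑ x ∈ B, (Nat.multinomial (Finset.Ico k J) x.2 : ℝ) *
          ∏ j ∈ Finset.Ico k J, y j ^ x.2 j := by
        rw [Finset.sum_product, Finset.sum_mul_sum]
    _ ≤ _ := mul_le_mul hA hB (Finset.sum_nonneg fun x _ => mul_nonneg (by positivity)
        (Finset.prod_nonneg fun j _ => pow_nonneg (hy j) _)) (by have := hq.2; positivity)

/-- If the coefficients `c n` satisfy Cauchy estimates on polydiscs with finitely many variables, with a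
bound depending on `∑ ρ_j / (1 - ρ_j)` only, then `∑ c_n x^{α(n)}` is bounded uniformly for all `x`
whose coordinates of index `j < k` are at most `R < 1`, and whose other coordinates have a small sum.
For each `n` the Cauchy estimate is used with radii depending on `n`: the tail radii are proportional
to the exponents `α_j(n)`. -/
theorem exists_sum_monomial_le {c : ℕ → ℝ} (hc : ∀ n, 0 ≤ c n) {Φ : ℝ → ℝ} (hΦ : Monotone Φ)
    (hcoeff : ∀ n ≠ 0, ∀ (ρ : ℕ → ℝ) (m : ℕ), (∀ j, 0 ≤ ρ j) → (∀ j, ρ j < 1) →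
      (∀ j, m ≤ j → ρ j = 0) →
      c n * monomial n ρ ≤ Φ (∑ j ∈ Finset.range m, 2 * ρ j / (1 - ρ j)))
    (k : ℕ) {R : ℝ} (hR0 : 0 ≤ R) (hR1 : R < 1) :
    ∃ B : ℝ, ∀ x : ℕ → ℝ, (∀ j, 0 ≤ x j) → (∀ j < k, x j ≤ R) →
      (∀ J, ∑ j ∈ Finset.Ico k J, x j ≤ 1 / (4 * Real.exp 1)) →
      ∀ N, ∑ n ∈ Finset.Icc 1 N, c n * monomial n x ≤ B := by
  set R₁ : ℝ := (1 + R) / 2 with hR₁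
  have hR₁0 : 0 < R₁ := by positivity
  have hR₁1 : R₁ < 1 := by linarith
  have hRR₁ : R < R₁ := by linarith
  set q : ℝ := R / R₁ with hq
  have hq01 : q ∈ Ico (0 : ℝ) 1 := ⟨by positivity, (div_lt_one hR₁0).2 hRR₁⟩
  set M : ℝ := max 0 (Φ (k * (2 * R₁ / (1 - R₁)) + 2)) with hM
  refine ⟨M * ((1 - q)⁻¹ ^ k * 2), fun x hx hxR hxt N => ?_⟩
  set J : ℕ := N + 1 + k with hJ
  set I : Finset ℕ := Finset.Ico k J with hI
  have hsplit : ∀ (n : ℕ), n ∈ Finset.Icc 1 N → ∀ z : ℕ → ℝ, monomial n z =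
      (∏ j ∈ Finset.range k, z j ^ primeExponent n j) * ∏ j ∈ I, z j ^ primeExponent n j := by
    intro n hn z
    rw [monomial_eq_prod_range (J := J) (by have := (Finset.mem_Icc.1 hn).2; omega),
      Finset.prod_range_mul_prod_Ico _ (by omega)]
  set y : ℕ → ℝ := fun j => 2 * Real.exp 1 * x j with hy
  have hy0 : ∀ j, 0 ≤ y j := fun j => mul_nonneg (by positivity) (hx j)
  have hysum : ∑ j ∈ I, y j ≤ 1 / 2 := by
    rw [← Finset.mul_sum]
    calc _ ≤ 2 * Real.exp 1 * (1 / (4 * Real.exp 1)) :=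
          mul_le_mul_of_nonneg_left (hxt J) (by positivity)
      _ = 1 / 2 := by field_simp; norm_num
  refine le_trans ?_ (mul_le_mul_of_nonneg_left
    (sum_geometric_mul_multinomial_le k N J (by omega) hq01 hy0 hysum) (le_max_left _ _))
  rw [Finset.mul_sum]
  refine Finset.sum_le_sum fun n hn => ?_
  set β := primeExponent n with hβ
  set m : ℕ := ∑ j ∈ I, β j with hm
  -- The radii of the polydisc: `R₁` for the first `k` coordinates, `β_j / (2m)` for the others.
  set ρ : ℕ → ℝ := fun j => if j < k then R₁ else if j < J then (β j : ℝ) / m / 2 else 0 with hρ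
  have hρtail : ∀ j ∈ I, ρ j = (β j : ℝ) / m / 2 := fun j hj => by
    have := Finset.mem_Ico.1 hj
    simp [hρ, this.2, not_lt.2 this.1]
  have hle : ∀ j ∈ I, (β j : ℝ) / m ≤ 1 := fun j hj => by
    refine div_le_one_of_le₀ ?_ (by positivity)
    exact_mod_cast Finset.single_le_sum (f := β) (fun _ _ => Nat.zero_le _) hj
  have hρ0 : ∀ j, 0 ≤ ρ j := fun j => by
    simp only [hρ]; split_ifs <;> positivity
  have hρ1 : ∀ j, ρ j < 1 := fun j => by
    by_cases h1 : j < k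
    · simpa [hρ, h1] using hR₁1
    · by_cases h2 : j < J
      · have h3 : j ∈ I := Finset.mem_Ico.2 ⟨not_lt.1 h1, h2⟩
        rw [hρtail j h3]
        linarith [hle j h3]
      · simp [hρ, h1, h2]
  have hbound : c n * monomial n ρ ≤ M := by
    refine (hcoeff n (by have := (Finset.mem_Icc.1 hn).1; omega) ρ J hρ0 hρ1 fun j hj => ?_).trans
      ((hΦ ?_).trans (le_max_right _ _))
    · have h1 : ¬ j < k := by omega
      simp [hρ, h1, not_lt.2 hj]
    · rw [← Finset.sum_range_add_sum_Ico _ (show k ≤ J by omega)]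
      refine add_le_add ?_ ?_
      · rw [Finset.sum_congr rfl (g := fun _ => 2 * R₁ / (1 - R₁))]
        · simp
        · intro j hj
          simp [hρ, Finset.mem_range.1 hj]
      · calc _ ≤ ∑ j ∈ I, 2 * ((β j : ℝ) / m) := by
              refine Finset.sum_le_sum fun j hj => ?_
              have h1 := hle j hj
              have h2 : 0 ≤ (β j : ℝ) / m := by positivity
              rw [hρtail j hj, div_le_iff₀ (by linarith)]
              nlinarith
          _ = 2 * ((m : ℝ) / m) := by
              rw [← Finset.mul_sum, ← Finset.sum_div, hm]
              push_cast
              rfl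
          _ ≤ 2 := by linarith [div_self_le_one (m : ℝ)]
  have hmain : monomial n x ≤ monomial n ρ * ((∏ j ∈ Finset.range k, q ^ β j) *
      (Nat.multinomial I β * ∏ j ∈ I, y j ^ β j)) := by
    rw [hsplit n hn x, hsplit n hn ρ]
    have hhead : ∏ j ∈ Finset.range k, x j ^ β j ≤
        (∏ j ∈ Finset.range k, ρ j ^ β j) * ∏ j ∈ Finset.range k, q ^ β j := by
      rw [← Finset.prod_mul_distrib]
      refine Finset.prod_le_prod (fun j _ => pow_nonneg (hx j) _) fun j hj => ?_
      have hj' := Finset.mem_range.1 hj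
      have : ρ j * q = R := by
        simp only [hρ, hj', if_true, hq]
        field_simp
      rw [← mul_pow, this]
      exact pow_le_pow_left₀ (hx j) (hxR j hj') _
    have htail : ∏ j ∈ I, x j ^ β j ≤
        (∏ j ∈ I, ρ j ^ β j) * (Nat.multinomial I β * ∏ j ∈ I, y j ^ β j) := by
      have h1 : (∏ j ∈ I, ρ j ^ β j) * ∏ j ∈ I, y j ^ β j =
          (∏ j ∈ I, ((β j : ℝ) / m) ^ β j) * Real.exp m * ∏ j ∈ I, x j ^ β j := by
        have h2 : Real.exp m = ∏ j ∈ I, Real.exp 1 ^ β j := by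
          rw [Finset.prod_pow_eq_pow_sum, ← Real.exp_nat_mul, mul_one]
        rw [h2, ← Finset.prod_mul_distrib, ← Finset.prod_mul_distrib, ← Finset.prod_mul_distrib]
        refine Finset.prod_congr rfl fun j hj => ?_
        rw [hρtail j hj, ← mul_pow, ← mul_pow, ← mul_pow]
        congr 1
        simp only [hy]
        ring
      have h3 := mul_le_mul_of_nonneg_right (one_le_prod_mul_exp_mul_multinomial I β)
        (Finset.prod_nonneg fun j (_ : j ∈ I) => pow_nonneg (hx j) (β j))
      rw [one_mul] at h3
      refine h3.trans_eq ?_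
      linear_combination -(Nat.multinomial I β : ℝ) * h1
    refine (mul_le_mul hhead htail (Finset.prod_nonneg fun j _ => pow_nonneg (hx j) _)
      (mul_nonneg (Finset.prod_nonneg fun j _ => pow_nonneg (hρ0 j) _)
        (Finset.prod_nonneg fun j _ => pow_nonneg hq01.1 _))).trans_eq ?_
    ring
  calc c n * monomial n x ≤ c n * (monomial n ρ * ((∏ j ∈ Finset.range k, q ^ β j) *
        (Nat.multinomial I β * ∏ j ∈ I, y j ^ β j))) := mul_le_mul_of_nonneg_left hmain (hc n)
    _ = (c n * monomial n ρ) * ((∏ j ∈ Finset.range k, q ^ β j) *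
        (Nat.multinomial I β * ∏ j ∈ I, y j ^ β j)) := by ring
    _ ≤ _ := mul_le_mul_of_nonneg_right hbound (mul_nonneg
        (Finset.prod_nonneg fun j _ => pow_nonneg hq01.1 _) (mul_nonneg (by positivity)
          (Finset.prod_nonneg fun j _ => pow_nonneg (hy0 j) _)))

/-! ### Coefficient estimates for Dirichlet series in `𝒩_u` -/

theorem differentiable_monomial (n : ℕ) {f : ℂ → ℕ → ℂ}
    (hf : ∀ j, Differentiable ℂ fun x => f x j) : Differentiable ℂ fun x => monomial n (f x) := by
  unfold monomial Finsupp.prod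
  exact Differentiable.fun_finsetProd fun p _ => (hf _).pow _

theorem inPolydiscAlgebra_bohrPoly (a : ArithmeticFunction ℂ) (N : ℕ) (ρ : ℕ → ℝ) :
    InPolydiscAlgebra fun z => bohrPoly a N fun j => ρ j * z j := by
  refine ⟨((continuous_bohrPoly a N).comp (by fun_prop)).continuousOn, fun z _ j => ?_⟩
  refine Differentiable.differentiableOn ?_
  unfold bohrPoly
  refine Differentiable.fun_sum fun n _ => (differentiable_monomial n fun i => ?_).const_mul _
  refine Differentiable.const_mul ?_ _
  rcases eq_or_ne i j with rfl | hij
  · simp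
  · simp [hij]

theorem prod_le_exp_sum {s : Finset ℕ} {x : ℕ → ℝ} (h0 : ∀ j, 0 ≤ x j) (h1 : ∀ j, x j < 1) :
    ∏ j ∈ s, (1 + x j) / (1 - x j) ≤ Real.exp (∑ j ∈ s, 2 * x j / (1 - x j)) := by
  rw [Real.exp_sum]
  refine Finset.prod_le_prod (fun j _ => div_nonneg (by linarith [h0 j]) (by linarith [h1 j]))
    fun j _ => ?_
  have h2 : (1 + x j) / (1 - x j) = 2 * x j / (1 - x j) + 1 := by
    have : 1 - x j ≠ 0 := by linarith [h1 j]
    field_simp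
    ring
  rw [h2]
  exact Real.add_one_le_exp _

/-- The bound of a function in the polydisc algebra by its mean over the torus, at points with
finitely many nonzero coordinates. -/
theorem InPolydiscAlgebra.logOneAdd_le_exp {h : (ℕ → ℂ) → ℂ} (hh : InPolydiscAlgebra h)
    {z : ℕ → ℂ} (hz : ∀ j, ‖z j‖ < 1) {m : ℕ} (hm : ∀ j, m ≤ j → z j = 0) :
    logOneAdd (h z) ≤ Real.exp (∑ j ∈ Finset.range m, 2 * ‖z j‖ / (1 - ‖z j‖)) *
      ∫ w, logOneAdd (h (torusPoint w)) ∂torusMeasure := by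
  refine hh.logOneAdd_le hz fun m' => (prod_le_exp_sum (fun j => norm_nonneg _) hz).trans
    (Real.exp_le_exp.2 ?_)
  have h0 : ∀ j, 0 ≤ 2 * ‖z j‖ / (1 - ‖z j‖) := fun j =>
    div_nonneg (by positivity) (by linarith [hz j])
  refine (Finset.sum_le_sum_of_subset_of_nonneg (t := Finset.range (max m m'))
    (Finset.range_mono (le_max_right _ _)) fun j _ _ => h0 j).trans_eq ?_
  refine (Finset.sum_subset (Finset.range_mono (le_max_left _ _)) fun j _ hj => ?_).symm
  simp [hm j (by simpa using hj)]

/-- **Cauchy's estimate** for the coefficients of a polynomial. -/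
theorem norm_coeff_mul_monomial_le (a : ArithmeticFunction ℂ) {N n : ℕ} (hn : n ∈ Finset.Icc 1 N)
    (ρ : ℕ → ℝ) {B : ℝ} (hB : ∀ w, ‖bohrPoly a N fun j => ρ j * torusPoint w j‖ ≤ B) :
    ‖a n‖ * |monomial n ρ| ≤ B := by
  have hn0 : n ≠ 0 := by have := (Finset.mem_Icc.1 hn).1; omega
  have hexp : ∀ w, (bohrPoly a N fun j => ρ j * torusPoint w j) * star (monomial n (torusPoint w)) =
      ∑ k ∈ Finset.Icc 1 N, (a k * (monomial k ρ : ℝ)) * torusChar k n w := fun w => by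
    rw [bohrPoly, Finset.sum_mul]
    refine Finset.sum_congr rfl fun k _ => ?_
    rw [monomial_mul]
    have : ((monomial k ρ : ℝ) : ℂ) = monomial k fun j => (ρ j : ℂ) :=
      map_monomial Complex.ofRealHom k ρ
    simp only [torusChar, ContinuousMap.coe_mk, this]
    ring
  have hint : ∫ w, (bohrPoly a N fun j => ρ j * torusPoint w j) *
      star (monomial n (torusPoint w)) ∂torusMeasure = a n * (monomial n ρ : ℝ) := by
    simp_rw [hexp]
    rw [integral_finsetSum _ fun k _ =>
      (integrable_of_continuous (torusChar k n).continuous).const_mul _]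
    simp_rw [integral_const_mul]
    rw [Finset.sum_eq_single_of_mem n hn]
    · simp [integral_torusChar hn0 hn0]
    · intro k hk hkn
      have hk0 : k ≠ 0 := by have := (Finset.mem_Icc.1 hk).1; omega
      simp [integral_torusChar hk0 hn0, hkn]
  have h := norm_integral_le_of_norm_le_const (μ := torusMeasure) (C := B)
    (f := fun w => (bohrPoly a N fun j => ρ j * torusPoint w j) * star (monomial n (torusPoint w)))
    (Eventually.of_forall fun w => by
      rw [norm_mul, norm_star, norm_monomial_torusPoint, mul_one]; exact hB w)
  rw [hint] at h
  simpa using h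

theorem integral_logOneAdd_le_dirichletNorm {a : ArithmeticFunction ℂ} (ha : MemNu a) {σ : ℝ}
    (hσ : 0 < σ) {G : C(ℕ → UnitAddCircle, ℂ)}
    (hG : ∀ t : ℝ, dirichletSum a ((σ : ℂ) + t * Complex.I) = G (kroneckerFlow t)) :
    ∫ w, logOneAdd (G w) ∂torusMeasure ≤ (dirichletNorm a).toReal := by
  have h1 : lineNorm a σ ≤ dirichletNorm a :=
    le_iSup (fun σ : Ioi (0 : ℝ) => lineNorm a σ) ⟨σ, hσ⟩
  rw [lineNorm_eq hG] at h1
  exact (ENNReal.ofReal_le_iff_le_toReal ha.2.ne).1 h1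

/-- For a Dirichlet series in `𝒩_u`, the coefficients satisfy the Cauchy estimates of a function which
grows like the exponential of a Harnack constant. -/
theorem norm_coeff_mul_monomial_le_exp {a : ArithmeticFunction ℂ} (ha : MemNu a) {n : ℕ}
    (hn : n ≠ 0) {ρ : ℕ → ℝ} {m : ℕ} (hρ0 : ∀ j, 0 ≤ ρ j) (hρ1 : ∀ j, ρ j < 1)
    (hρm : ∀ j, m ≤ j → ρ j = 0) :
    ‖a n‖ * monomial n ρ ≤ Real.exp (Real.exp (∑ j ∈ Finset.range m, 2 * ρ j / (1 - ρ j)) *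
      (dirichletNorm a).toReal) := by
  -- The polynomials are estimated on the line of abscissa `σ > 0`, where the radii are `s σ j`.
  let s : ℝ → ℕ → ℝ := fun σ j => ρ j * (prime j : ℝ) ^ σ
  have hp : ∀ j, (0 : ℝ) < prime j := fun j => by exact_mod_cast (prime_prime j).pos
  have hs0 : ∀ σ j, 0 ≤ s σ j := fun σ j => mul_nonneg (hρ0 j) (Real.rpow_nonneg (hp j).le _)
  have hsρ : ∀ σ j, primeRadius σ j * s σ j = ρ j := fun σ j => by
    simp only [s, primeRadius]
    rw [mul_left_comm, ← Real.rpow_add (hp j), neg_add_cancel, Real.rpow_zero, mul_one]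
  have hsc : ∀ j, Tendsto (fun σ => s σ j) (𝓝[>] 0) (𝓝 (ρ j)) := fun j => by
    have h1 : Continuous fun σ : ℝ => s σ j :=
      continuous_const.mul (Real.continuous_const_rpow (hp j).ne')
    have h2 := (h1.tendsto 0).mono_left (nhdsWithin_le_nhds (s := Ioi (0 : ℝ)))
    simpa [s] using h2
  have hlim : Tendsto (fun σ => Real.exp (Real.exp (∑ j ∈ Finset.range m,
      2 * s σ j / (1 - s σ j)) * (dirichletNorm a).toReal)) (𝓝[>] 0)
      (𝓝 (Real.exp (Real.exp (∑ j ∈ Finset.range m, 2 * ρ j / (1 - ρ j)) *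
        (dirichletNorm a).toReal))) := by
    refine (Real.continuous_exp.tendsto _).comp (Tendsto.mul_const _
      ((Real.continuous_exp.tendsto _).comp (tendsto_finsetSum _ fun j _ => ?_)))
    exact ((hsc j).const_mul 2).div (tendsto_const_nhds.sub (hsc j)) (by linarith [hρ1 j])
  refine ge_of_tendsto hlim ?_
  have hev : ∀ᶠ σ in 𝓝[>] (0 : ℝ), ∀ j ∈ Finset.range m, s σ j < 1 :=
    (Finset.eventually_all _).2 fun j _ => (hsc j).eventually_lt_const (hρ1 j)
  filter_upwards [hev, self_mem_nhdsWithin] with σ hσs hσ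
  obtain ⟨G, hG, hGf⟩ := exists_tendsto_linePoly ha.1 hσ
  have hs1 : ∀ j, s σ j < 1 := fun j => by
    by_cases hj : j < m
    · exact hσs j (Finset.mem_range.2 hj)
    · simp [s, hρm j (not_lt.1 hj)]
  set S := ∑ j ∈ Finset.range m, 2 * s σ j / (1 - s σ j)
  have hpoly : ∀ N, n ≤ N → ‖a n‖ * monomial n ρ ≤
      Real.exp (Real.exp S * ∫ w, logOneAdd (linePoly a σ N w) ∂torusMeasure) := by
    intro N hN
    rw [← abs_of_nonneg (monomial_nonneg n hρ0)]
    refine norm_coeff_mul_monomial_le a (Finset.mem_Icc.2 ⟨by omega, hN⟩) ρ fun w => ?_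
    have hnorm : ∀ j, ‖(s σ j : ℂ) * torusPoint w j‖ = s σ j := fun j => by
      have : ‖torusPoint w j‖ = 1 := norm_expCircle _
      rw [norm_mul, this, mul_one, Complex.norm_real, Real.norm_of_nonneg (hs0 σ j)]
    have h1 := (inPolydiscAlgebra_bohrPoly a N (primeRadius σ)).logOneAdd_le_exp
      (z := fun j => s σ j * torusPoint w j) (fun j => by rw [hnorm]; exact hs1 j) (m := m)
      fun j hj => by simp [s, hρm j hj]
    simp only [hnorm, ← mul_assoc, ← Complex.ofReal_mul, hsρ] at h1
    have h2 := Real.exp_le_exp.2 h1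
    rw [exp_logOneAdd] at h2
    exact (by linarith : ‖bohrPoly a N fun j => ρ j * torusPoint w j‖ ≤ _).trans h2
  have hlimN := (Real.continuous_exp.tendsto _).comp
    ((tendsto_integral_logOneAdd hG).const_mul (Real.exp S))
  refine (ge_of_tendsto hlimN ?_).trans (Real.exp_le_exp.2 (mul_le_mul_of_nonneg_left
    (integral_logOneAdd_le_dirichletNorm ha hσ hGf) (Real.exp_pos _).le))
  filter_upwards [eventually_ge_atTop n] with N hN using hpoly N hN

/-! ### The Bohr lift as a holomorphic function -/

theorem bohrMonomial_eq (n : ℕ) (ζ : Ell1) : bohrMonomial n ζ = monomial n ζ := rfl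

theorem ell1_sub_apply (ζ η : Ell1) (j : ℕ) : (ζ - η) j = ζ j - η j := rfl

theorem ell1_add_smul_apply (ζ ξ : Ell1) (z : ℂ) (j : ℕ) : (ζ + z • ξ) j = ζ j + z * ξ j := rfl

theorem norm_ell1_le_add (η ζ : Ell1) (j : ℕ) : ‖η j‖ ≤ ‖(η - ζ) j‖ + ‖ζ j‖ := by
  simpa [ell1_sub_apply] using norm_add_le ((η - ζ) j) (ζ j)

theorem summable_norm_ell1 (ζ : Ell1) : Summable fun j => ‖ζ j‖ := by
  simpa using (lp.memℓp ζ).summable (by simp)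

theorem norm_ell1_eq_tsum (ζ : Ell1) : ‖ζ‖ = ∑' j, ‖ζ j‖ := by
  rw [lp.norm_eq_tsum_rpow (by simp)]
  simp

theorem sum_norm_le_norm_ell1 (ζ : Ell1) (s : Finset ℕ) : ∑ j ∈ s, ‖ζ j‖ ≤ ‖ζ‖ := by
  rw [norm_ell1_eq_tsum]
  exact (summable_norm_ell1 ζ).sum_le_tsum _ fun _ _ => norm_nonneg _

/-- A point of `𝔻₁^∞` has a neighbourhood on which the coordinates stay away from the unit circle. -/
theorem exists_radius (ζ : D1) : ∃ R ∈ Ioo (0 : ℝ) 1, ∃ δ > 0,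
    ∀ η : Ell1, ‖η - ζ‖ < δ → ∀ j, ‖η j‖ ≤ R := by
  obtain ⟨δ, hδ, h⟩ := Metric.isOpen_iff.1 isOpen_D1 ζ ζ.2
  set ε := min δ 1 / 2 with hε
  have hε0 : 0 < ε := by positivity
  have hε1 : ε < 1 := by have := min_le_right δ 1; linarith
  have hεδ : ε < δ := by have := min_le_left δ 1; linarith
  -- increasing the modulus of one coordinate by `ε` does not lead out of `𝔻₁^∞`
  have hζ : ∀ j, ‖(ζ : Ell1) j‖ ≤ 1 - ε := by
    intro j
    obtain ⟨c, hc, hcz⟩ : ∃ c : ℂ, ‖c‖ = 1 ∧ (ζ : Ell1) j = ‖(ζ : Ell1) j‖ * c := by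
      obtain ⟨c, hc, h⟩ := RCLike.exists_norm_mul_eq_self ((ζ : Ell1) j)
      exact ⟨c, hc, h.symm.trans (mul_comm _ _)⟩
    have hmem : (ζ : Ell1) + lp.single 1 j ((ε : ℂ) * c) ∈ D1 := by
      refine h ?_
      rw [Metric.mem_ball, dist_eq_norm, add_sub_cancel_left, lp.norm_single (by simp), norm_mul, hc,
        mul_one, Complex.norm_real, Real.norm_of_nonneg hε0.le]
      exact hεδ
    have h1 := hmem j
    rw [lp.coeFn_add, Pi.add_apply, lp.single_apply_self, hcz, ← add_mul, norm_mul, hc, mul_one,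
      ← Complex.ofReal_add, Complex.norm_real, Real.norm_of_nonneg (by positivity)] at h1
    linarith
  refine ⟨1 - ε / 2, ⟨by linarith, by linarith⟩, ε / 2, by positivity, fun η hη j => ?_⟩
  have h1 := lp.norm_apply_le_norm (p := 1) (by simp) (η - (ζ : Ell1)) j
  linarith [hζ j, norm_ell1_le_add η ζ j]

/-- Absolute convergence of the lifted series, locally uniformly bounded on `𝔻₁^∞`. -/
theorem exists_sum_norm_bohr_le {a : ArithmeticFunction ℂ} (ha : MemNu a) (ζ : D1) :
    ∃ δ > 0, ∃ B : ℝ, ∀ η : Ell1, ‖η - ζ‖ < δ →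
      ∀ N, ∑ n ∈ Finset.range N, ‖a n * bohrMonomial n η‖ ≤ B := by
  obtain ⟨R, hR, δ, hδ, hηR⟩ := exists_radius ζ
  set κ : ℝ := 1 / (4 * Real.exp 1) with hκ
  have hκ0 : 0 < κ := by positivity
  -- the tail of `ζ` is small, and stays small for the points close to `ζ`
  obtain ⟨k, hk⟩ : ∃ k, ∀ J, ∑ j ∈ Finset.Ico k J, ‖(ζ : Ell1) j‖ ≤ κ / 2 := by
    obtain ⟨s, hs⟩ := (summable_iff_vanishing_norm.1 (summable_norm_ell1 ζ)) (κ / 2) (by positivity)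
    refine ⟨s.sup id + 1, fun J => (le_abs_self _).trans (hs _ ?_).le⟩
    rw [Finset.disjoint_left]
    intro j hj hjs
    have h1 := Finset.le_sup (f := id) hjs
    have h2 := (Finset.mem_Ico.1 hj).1
    simp only [id] at h1
    omega
  obtain ⟨B, hB⟩ := exists_sum_monomial_le (c := fun n => ‖a n‖) (fun n => norm_nonneg _)
    (Φ := fun S => Real.exp (Real.exp S * (dirichletNorm a).toReal))
    (fun S T hST => Real.exp_le_exp.2 (mul_le_mul_of_nonneg_right (Real.exp_le_exp.2 hST)
      ENNReal.toReal_nonneg))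
    (fun n hn ρ m h0 h1 hm => norm_coeff_mul_monomial_le_exp ha hn h0 h1 hm) k hR.1.le hR.2
  refine ⟨min δ (κ / 2), by positivity, B, fun η hη N => ?_⟩
  have h1 := hB (fun j => ‖η j‖) (fun j => norm_nonneg _)
    (fun j _ => hηR η (hη.trans_le (min_le_left _ _)) j) (fun J => ?_) N
  · refine le_trans ?_ h1
    rw [Finset.range_eq_Ico]
    calc ∑ n ∈ Finset.Ico 0 N, ‖a n * bohrMonomial n η‖
        ≤ ∑ n ∈ Finset.Icc 0 N, ‖a n * bohrMonomial n η‖ :=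
          Finset.sum_le_sum_of_subset_of_nonneg Finset.Ico_subset_Icc_self
            fun _ _ _ => norm_nonneg _
      _ = ∑ n ∈ Finset.Icc 1 N, ‖a n * bohrMonomial n η‖ := by
          rw [← Finset.add_sum_Ioc_eq_sum_Icc (Nat.zero_le N)]
          simp only [ArithmeticFunction.map_zero, zero_mul, norm_zero, zero_add]
          rfl
      _ = _ := Finset.sum_congr rfl fun n _ => by rw [norm_mul, bohrMonomial_eq, norm_monomial]
  · calc ∑ j ∈ Finset.Ico k J, ‖η j‖
        ≤ ∑ j ∈ Finset.Ico k J, (‖(η - (ζ : Ell1)) j‖ + ‖(ζ : Ell1) j‖) :=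
          Finset.sum_le_sum fun j _ => norm_ell1_le_add η ζ j
      _ ≤ κ / 2 + κ / 2 := by
          rw [Finset.sum_add_distrib]
          exact add_le_add ((sum_norm_le_norm_ell1 _ _).trans
            (hη.le.trans (min_le_right _ _))) (hk J)
      _ = κ := add_halves κ

theorem summable_norm_bohr {a : ArithmeticFunction ℂ} (ha : MemNu a) (ζ : D1) :
    Summable fun n => ‖a n * bohrMonomial n ζ‖ := by
  obtain ⟨δ, hδ, B, hB⟩ := exists_sum_norm_bohr_le ha ζ
  exact summable_of_sum_range_le (fun _ => norm_nonneg _) (hB ζ (by simpa using hδ))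

/-- The sequence of absolute values of a sequence in `ℓ¹`. -/
noncomputable def absEll1 (ζ : Ell1) : Ell1 :=
  ⟨fun j => (‖ζ j‖ : ℂ), memℓp_gen (by simpa using summable_norm_ell1 ζ)⟩

theorem absEll1_apply (ζ : Ell1) (j : ℕ) : absEll1 ζ j = (‖ζ j‖ : ℂ) := rfl

theorem norm_absEll1 (ζ : Ell1) : ‖absEll1 ζ‖ = ‖ζ‖ := by
  simp [norm_ell1_eq_tsum, absEll1_apply]

theorem isHolomorphic_bohrLift {a : ArithmeticFunction ℂ} (ha : MemNu a) :
    IsHolomorphic (bohrLift a) := by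
  refine ⟨fun ζ => ?_, fun ζ₀ ξ => ?_⟩
  · obtain ⟨δ, hδ, B, hB⟩ := exists_sum_norm_bohr_le ha ζ
    refine ⟨Metric.ball ζ δ, Metric.ball_mem_nhds _ hδ, B, fun η hη => ?_⟩
    have hη' : ‖(η : Ell1) - ζ‖ < δ := by
      rw [← dist_eq_norm]; exact hη
    exact (norm_tsum_le_tsum_norm (summable_norm_bohr ha η)).trans
      (Real.tsum_le_of_sum_range_le (fun _ => norm_nonneg _) (hB η hη'))
  · intro z₀ hz₀
    -- near `z₀` the series is dominated by its values at one point with nonnegative coordinates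
    set y : Ell1 := ζ₀ + z₀ • ξ with hy
    have hyD : absEll1 y ∈ D1 := fun j => by
      simpa only [absEll1_apply, Complex.norm_real, norm_norm] using hz₀ j
    obtain ⟨δ, hδ, hball⟩ := Metric.isOpen_iff.1 isOpen_D1 _ hyD
    set r : ℝ := δ / (‖ξ‖ + 1) / 2 with hr
    have hr0 : 0 < r := by positivity
    have hrδ : r * ‖ξ‖ < δ := by
      have h1 : r * (‖ξ‖ + 1) = δ / 2 := by rw [hr]; field_simp
      nlinarith [norm_nonneg ξ]
    set η : Ell1 := absEll1 y + (r : ℂ) • absEll1 ξ with hη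
    have hηj : ∀ j, η j = ((‖y j‖ + r * ‖ξ j‖ : ℝ) : ℂ) := fun j => by
      rw [hη, ell1_add_smul_apply, absEll1_apply, absEll1_apply]
      push_cast
      rfl
    have hηD : η ∈ D1 := by
      refine hball ?_
      rw [Metric.mem_ball, dist_eq_norm, hη, add_sub_cancel_left, norm_smul, norm_absEll1,
        Complex.norm_real, Real.norm_of_nonneg hr0.le]
      exact hrδ
    have hline : ∀ z ∈ Metric.ball z₀ r, ∀ j, ‖((ζ₀ : Ell1) + z • ξ) j‖ ≤ ‖η j‖ := by
      intro z hz j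
      have h1 : ((ζ₀ : Ell1) + z • ξ) j = y j + (z - z₀) * ξ j := by
        rw [hy, ell1_add_smul_apply, ell1_add_smul_apply]; ring
      rw [h1, hηj, Complex.norm_real, Real.norm_of_nonneg (by positivity)]
      refine (norm_add_le _ _).trans (add_le_add_right ?_ _)
      rw [norm_mul, ← dist_eq_norm]
      exact mul_le_mul_of_nonneg_right (Metric.mem_ball.1 hz).le (norm_nonneg _)
    have hin : ∀ z ∈ Metric.ball z₀ r, (ζ₀ : Ell1) + z • ξ ∈ D1 := fun z hz j =>
      (hline z hz j).trans_lt (hηD j)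
    have hd := Complex.differentiableOn_tsum_of_summable_norm
      (F := fun n z => a n * bohrMonomial n ((ζ₀ : Ell1) + z • ξ)) (U := Metric.ball z₀ r)
      (summable_norm_bohr ha ⟨η, hηD⟩) (fun n => ?_) Metric.isOpen_ball fun n z hz => ?_
    · refine DifferentiableAt.differentiableWithinAt ?_
      refine ((hd.congr fun z hz => ?_).differentiableAt (Metric.ball_mem_nhds _ hr0))
      exact Subtype.val_injective.extend_apply (bohrLift a) 0 ⟨_, hin z hz⟩
    · refine Differentiable.differentiableOn (Differentiable.const_mul ?_ _)
      refine differentiable_monomial n (f := fun z => ⇑((ζ₀ : Ell1) + z • ξ)) fun j => ?_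
      have : (fun z : ℂ => ((ζ₀ : Ell1) + z • ξ) j) = fun z => (ζ₀ : Ell1) j + z * ξ j := by
        funext z; exact ell1_add_smul_apply _ _ _ _
      rw [this]
      fun_prop
    · rw [norm_mul, norm_mul, bohrMonomial_eq, bohrMonomial_eq, norm_monomial, norm_monomial]
      exact mul_le_mul_of_nonneg_left (monomial_mono n (fun _ => norm_nonneg _) (hline z hz))
        (norm_nonneg _)

/-! ### The Bohr lift preserves the norm -/

/-- By Bertrand's postulate, the `j`-th prime, indexed from `0`, is at most `2^{j+1}`. -/
theorem prime_le_two_pow (j : ℕ) : prime j ≤ 2 ^ (j + 1) := by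
  induction j with
  | zero => simp [prime, Nat.nth_prime_zero_eq_two]
  | succ j ih =>
    obtain ⟨q, hq, hjq, hq2⟩ := Nat.exists_prime_lt_and_le_two_mul (prime j) (prime_prime j).ne_zero
    have h1 : prime (j + 1) ≤ q := by
      have h2 : j + 1 ≤ Nat.primeCounting' q := by
        rw [← Nat.lt_iff_add_one_le]
        have := Nat.count_strict_mono (prime_prime j) hjq
        rwa [← Nat.primeCounting', primeCounting'_prime] at this
      calc prime (j + 1) ≤ prime (Nat.primeCounting' q) :=
            Nat.nth_monotone Nat.infinite_setOfPred_prime h2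
        _ = q := prime_primeCounting' hq
    calc prime (j + 1) ≤ 2 * prime j := h1.trans hq2
      _ ≤ 2 ^ (j + 1 + 1) := by rw [pow_succ' 2 (j + 1)]; omega

theorem primeRadius_le (σ : ℝ) (hσ : 0 < σ) (j : ℕ) : primeRadius σ j ≤ (2 : ℝ) ^ (-σ) :=
  Real.rpow_le_rpow_of_nonpos two_pos (by exact_mod_cast (prime_prime j).two_le) (by linarith)

theorem pow_le_primeRadius (σ : ℝ) (hσ : 0 < σ) (j : ℕ) :
    ((2 : ℝ) ^ (-σ)) ^ (j + 1) ≤ primeRadius σ j := by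
  rw [← Real.rpow_natCast, ← Real.rpow_mul two_pos.le, mul_comm, Real.rpow_mul two_pos.le,
    Real.rpow_natCast]
  refine Real.rpow_le_rpow_of_nonpos (by exact_mod_cast (prime_prime j).pos) ?_ (by linarith)
  exact_mod_cast prime_le_two_pow j

/-- The mean of `log (1 + |Q|)` over the torus with radii `ρ` increases with `ρ`. -/
theorem integral_logOneAdd_radii_mono {Q : (ℕ → ℂ) → ℂ} {ρ' ρ : ℕ → ℝ}
    (hQ : InPolydiscAlgebra fun z => Q fun j => ρ j * z j) (h0 : ∀ j, 0 ≤ ρ' j)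
    (hle : ∀ j, ρ' j ≤ ρ j) :
    ∫ w, logOneAdd (Q fun j => ρ' j * torusPoint w j) ∂torusMeasure ≤
      ∫ w, logOneAdd (Q fun j => ρ j * torusPoint w j) ∂torusMeasure := by
  have h := hQ.integral_dilate_le (s := fun j => ρ' j / ρ j) fun j =>
    ⟨div_nonneg (h0 j) ((h0 j).trans (hle j)), div_le_one_of_le₀ (hle j) ((h0 j).trans (hle j))⟩
  have e : ∀ j, (ρ j : ℂ) * ((ρ' j / ρ j : ℝ) : ℂ) = ρ' j := fun j => by
    rw [← Complex.ofReal_mul]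
    congr 1
    by_cases hj : ρ j = 0
    · rw [hj, zero_mul]
      exact le_antisymm (h0 j) (hj ▸ hle j)
    · exact mul_div_cancel₀ _ hj
  simpa only [← mul_assoc, e] using h

theorem bohrPoly_congr (a : ArithmeticFunction ℂ) {N : ℕ} {x y : ℕ → ℂ}
    (h : ∀ j ≤ N, x j = y j) : bohrPoly a N x = bohrPoly a N y :=
  Finset.sum_congr rfl fun n hn => by
    rw [monomial_congr fun j hj => h j (hj.trans (Finset.mem_Icc.1 hn).2)]

theorem coe_dilate (r : Ioo (0 : ℝ) 1) (w : ℕ → UnitAddCircle) :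
    ⇑(dilate r w : Ell1) = fun j => (((r : ℝ) ^ (j + 1) : ℝ) : ℂ) * torusPoint w j := by
  funext j
  rw [Complex.ofReal_pow]
  rfl

theorem tendsto_bohrPoly_dilate {a : ArithmeticFunction ℂ} (ha : MemNu a) (r : Ioo (0 : ℝ) 1) :
    Tendsto (fun N => ∫ w, logOneAdd (bohrPoly a N fun j =>
        (((r : ℝ) ^ (j + 1) : ℝ) : ℂ) * torusPoint w j) ∂torusMeasure) atTop
      (𝓝 (∫ w, logOneAdd (bohrLift a (dilate r w)) ∂torusMeasure)) := by
  have hsum : ∀ w, Summable fun n => ‖a n * bohrMonomial n (dilate r w)‖ := fun w =>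
    summable_norm_bohr ha _
  have hnorm : ∀ w n, ‖a n * bohrMonomial n (dilate r w)‖ =
      ‖a n‖ * monomial n fun j => (r : ℝ) ^ (j + 1) := fun w n => by
    rw [norm_mul, bohrMonomial_eq, norm_monomial, coe_dilate]
    have : ∀ j, ‖(((r : ℝ) ^ (j + 1) : ℝ) : ℂ) * torusPoint w j‖ = (r : ℝ) ^ (j + 1) := fun j => by
      have h1 : ‖torusPoint w j‖ = 1 := norm_expCircle _
      rw [norm_mul, h1, mul_one, Complex.norm_real, Real.norm_of_nonneg (pow_nonneg r.2.1.le _)]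
    simp only [this]
  simp only [hnorm] at hsum
  have hpoly : ∀ N w, (bohrPoly a N fun j => (((r : ℝ) ^ (j + 1) : ℝ) : ℂ) * torusPoint w j) =
      ∑ n ∈ Finset.range (N + 1), a n * bohrMonomial n (dilate r w) := fun N w => by
    rw [Finset.range_eq_Ico, ← Finset.add_sum_Ioo_eq_sum_Ico (Nat.succ_pos N)]
    simp only [ArithmeticFunction.map_zero, zero_mul, zero_add, bohrPoly, bohrMonomial_eq,
      coe_dilate]
    refine Finset.sum_congr ?_ fun _ _ => rfl
    ext n
    simp only [Finset.mem_Icc, Finset.mem_Ioo]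
    omega
  refine tendsto_integral_of_dominated_convergence
    (fun _ => ∑' n, ‖a n‖ * monomial n fun j => (r : ℝ) ^ (j + 1)) (fun N => ?_)
    (integrable_const _) (fun N => Eventually.of_forall fun w => ?_)
    (Eventually.of_forall fun w => ?_)
  · refine (continuous_logOneAdd.comp ((continuous_bohrPoly a N).comp
      (continuous_pi fun j => ?_))).aestronglyMeasurable
    have : Continuous fun w => torusPoint w j := (continuous_apply j).comp continuous_torusPoint
    fun_prop
  · rw [Real.norm_of_nonneg (logOneAdd_nonneg _), hpoly]
    refine (logOneAdd_le_norm _).trans ((norm_sum_le _ _).trans ?_)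
    simp only [hnorm]
    exact (hsum 0).sum_le_tsum _ fun n _ => mul_nonneg (norm_nonneg _)
      (monomial_nonneg n fun j => pow_nonneg r.2.1.le _)
  · simp only [hpoly]
    refine (continuous_logOneAdd.tendsto _).comp ?_
    exact (summable_norm_bohr ha _).of_norm.hasSum.tendsto_sum_nat.comp (tendsto_add_atTop_nat 1)

theorem lintegral_dilate_eq {F : D1 → ℂ} (hF : IsHolomorphic F) (r : Ioo (0 : ℝ) 1) :
    ∫⁻ w, ENNReal.ofReal (Real.log (1 + ‖F (dilate r w)‖)) ∂torusMeasure =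
      ENNReal.ofReal (∫ w, logOneAdd (F (dilate r w)) ∂torusMeasure) := by
  rw [ofReal_integral_eq_lintegral_ofReal]
  · rfl
  · exact integrable_of_continuous
      (continuous_logOneAdd.comp ((hF.continuous isOpen_D1).comp (continuous_dilate r)))
  · exact Eventually.of_forall fun w => logOneAdd_nonneg _

theorem ofReal_integral_le_nevanlinnaNorm {F : D1 → ℂ} (hF : IsHolomorphic F)
    (r : Ioo (0 : ℝ) 1) :
    ENNReal.ofReal (∫ w, logOneAdd (F (dilate r w)) ∂torusMeasure) ≤ nevanlinnaNorm F := by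
  rw [← lintegral_dilate_eq hF]
  exact le_iSup (fun r : Ioo (0 : ℝ) 1 =>
    ∫⁻ θ, ENNReal.ofReal (Real.log (1 + ‖F (dilate r θ)‖)) ∂torusMeasure) r

theorem nevanlinnaNorm_bohrLift_le {a : ArithmeticFunction ℂ} (ha : MemNu a) :
    nevanlinnaNorm (bohrLift a) ≤ dirichletNorm a := by
  refine iSup_le fun r => ?_
  rw [lintegral_dilate_eq (isHolomorphic_bohrLift ha)]
  -- the line of abscissa `σ` with `r = 2^{-σ}` has larger radii
  set σ : ℝ := -Real.logb 2 r with hσ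
  have hσ0 : 0 < σ := by
    rw [hσ, neg_pos]
    exact Real.logb_neg one_lt_two r.2.1 r.2.2
  have hr : (2 : ℝ) ^ (-σ) = r := by
    rw [hσ, neg_neg, Real.rpow_logb two_pos (by norm_num) r.2.1]
  obtain ⟨G, hG, hGf⟩ := exists_tendsto_linePoly ha.1 hσ0
  have hle : ∫ w, logOneAdd (bohrLift a (dilate r w)) ∂torusMeasure ≤
      ∫ w, logOneAdd (G w) ∂torusMeasure := by
    refine le_of_tendsto_of_tendsto' (tendsto_bohrPoly_dilate ha r)
      (tendsto_integral_logOneAdd hG) fun N => ?_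
    refine integral_logOneAdd_radii_mono (inPolydiscAlgebra_bohrPoly a N _)
      (fun j => pow_nonneg r.2.1.le _) fun j => ?_
    rw [← hr]
    exact pow_le_primeRadius σ hσ0 j
  refine (ENNReal.ofReal_le_ofReal hle).trans ?_
  rw [← lineNorm_eq hGf]
  exact le_iSup (fun σ : Ioi (0 : ℝ) => lineNorm a σ) ⟨σ, hσ0⟩

/-- A polynomial of length `N` on the line of abscissa `σ` involves finitely many variables only, and
these can be compared with the variables of a dilation `(r w_1, r² w_2, …)` with `r` close to `1`. -/
theorem integral_linePoly_le {a : ArithmeticFunction ℂ} (ha : MemNu a) {σ : ℝ} (hσ : 0 < σ)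
    (N : ℕ) {G : C(ℕ → UnitAddCircle, ℂ)} (hG : Tendsto (linePoly a σ) atTop (𝓝 G)) :
    ∫ w, logOneAdd (linePoly a σ N w) ∂torusMeasure ≤
      (∫ w, logOneAdd ((linePoly a σ N - G) w) ∂torusMeasure) +
        (nevanlinnaNorm (bohrLift a)).toReal := by
  have hfin : nevanlinnaNorm (bohrLift a) ≠ ⊤ := ((nevanlinnaNorm_bohrLift_le ha).trans_lt ha.2).ne
  set r : ℝ := (2 : ℝ) ^ (-σ / (N + 1)) with hr
  have hr0 : 0 < r := Real.rpow_pos_of_pos two_pos _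
  have hr1 : r < 1 := Real.rpow_lt_one_of_one_lt_of_neg one_lt_two
    (div_neg_of_neg_of_pos (by linarith) (by positivity))
  have hrN : r ^ (N + 1) = (2 : ℝ) ^ (-σ) := by
    rw [hr, ← Real.rpow_natCast, ← Real.rpow_mul two_pos.le]
    congr 1
    push_cast
    field_simp
  let r' : Ioo (0 : ℝ) 1 := ⟨r, hr0, hr1⟩
  let ρ : ℕ → ℝ := fun j => if j ≤ N then primeRadius σ j else 0
  have hρ0 : ∀ j, 0 ≤ ρ j := fun j => by
    simp only [ρ]; split_ifs
    · exact (primeRadius_pos σ j).le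
    · exact le_rfl
  have hρσ : ∀ j, ρ j ≤ primeRadius σ j := fun j => by
    simp only [ρ]; split_ifs
    · exact le_rfl
    · exact (primeRadius_pos σ j).le
  have hρr : ∀ j, ρ j ≤ r ^ (j + 1) := fun j => by
    simp only [ρ]; split_ifs with hj
    · refine (primeRadius_le σ hσ j).trans ?_
      rw [← hrN]
      exact pow_le_pow_of_le_one hr0.le hr1.le (by omega)
    · positivity
  have hcont : ∀ K, Continuous fun w => bohrPoly a K fun j => ρ j * torusPoint w j := fun K => by
    refine (continuous_bohrPoly a K).comp (continuous_pi fun j => ?_)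
    have : Continuous fun w => torusPoint w j := (continuous_apply j).comp continuous_torusPoint
    fun_prop
  have key : ∀ K, ∫ w, logOneAdd (linePoly a σ N w) ∂torusMeasure ≤
      (∫ w, logOneAdd ((linePoly a σ N - linePoly a σ K) w) ∂torusMeasure) +
      ∫ w, logOneAdd (bohrPoly a K fun j => ((r ^ (j + 1) : ℝ) : ℂ) * torusPoint w j)
        ∂torusMeasure := by
    intro K
    have h1 : ∀ w, linePoly a σ N w = bohrPoly a N fun j => ρ j * torusPoint w j := fun w =>
      bohrPoly_congr a fun j hj => by simp [ρ, hj]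
    calc ∫ w, logOneAdd (linePoly a σ N w) ∂torusMeasure
        ≤ ∫ w, (logOneAdd ((bohrPoly a N fun j => ρ j * torusPoint w j) -
            bohrPoly a K fun j => ρ j * torusPoint w j) +
            logOneAdd (bohrPoly a K fun j => ρ j * torusPoint w j)) ∂torusMeasure := by
          refine integral_mono (integrable_of_continuous
            (continuous_logOneAdd.comp (linePoly a σ N).continuous))
            (integrable_of_continuous ((continuous_logOneAdd.comp ((hcont N).sub (hcont K))).add
              (continuous_logOneAdd.comp (hcont K)))) fun w => ?_
          simp only [h1]
          refine le_trans (le_of_eq ?_) (logOneAdd_add_le _ _)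
          rw [sub_add_cancel]
      _ = (∫ w, logOneAdd ((bohrPoly a N fun j => ρ j * torusPoint w j) -
            bohrPoly a K fun j => ρ j * torusPoint w j) ∂torusMeasure) +
            ∫ w, logOneAdd (bohrPoly a K fun j => ρ j * torusPoint w j) ∂torusMeasure :=
          integral_add (integrable_of_continuous
            (continuous_logOneAdd.comp ((hcont N).sub (hcont K))))
            (integrable_of_continuous (continuous_logOneAdd.comp (hcont K)))
      _ ≤ _ := add_le_add
          (integral_logOneAdd_radii_mono (Q := fun z => bohrPoly a N z - bohrPoly a K z)
            ((inPolydiscAlgebra_bohrPoly a N _).sub (inPolydiscAlgebra_bohrPoly a K _)) hρ0 hρσ)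
          (integral_logOneAdd_radii_mono (inPolydiscAlgebra_bohrPoly a K _) hρ0 hρr)
  have hlim := (tendsto_integral_logOneAdd (hG.const_sub (linePoly a σ N))).add
    (tendsto_bohrPoly_dilate ha r')
  refine (ge_of_tendsto' hlim key).trans (add_le_add_right ?_ _)
  exact (ENNReal.ofReal_le_iff_le_toReal hfin).1
    (ofReal_integral_le_nevanlinnaNorm (isHolomorphic_bohrLift ha) r')

theorem nevanlinnaNorm_bohrLift {a : ArithmeticFunction ℂ} (ha : MemNu a) :
    nevanlinnaNorm (bohrLift a) = dirichletNorm a := by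
  refine le_antisymm (nevanlinnaNorm_bohrLift_le ha) (iSup_le fun σ => ?_)
  obtain ⟨G, hG, hGf⟩ := exists_tendsto_linePoly ha.1 σ.2
  have hfin : nevanlinnaNorm (bohrLift a) ≠ ⊤ := ((nevanlinnaNorm_bohrLift_le ha).trans_lt ha.2).ne
  rw [lineNorm_eq hGf, ENNReal.ofReal_le_iff_le_toReal hfin]
  have h1 : Tendsto (fun N => (∫ w, logOneAdd ((linePoly a σ N - G) w) ∂torusMeasure) +
      (nevanlinnaNorm (bohrLift a)).toReal) atTop
      (𝓝 ((∫ w, logOneAdd ((G - G) w) ∂torusMeasure) + (nevanlinnaNorm (bohrLift a)).toReal)) :=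
    (tendsto_integral_logOneAdd (hG.sub_const G)).add_const _
  have h2 : ∫ w, logOneAdd ((G - G) w) ∂torusMeasure = 0 := by simp [logOneAdd]
  rw [h2, zero_add] at h1
  exact le_of_tendsto_of_tendsto' (tendsto_integral_logOneAdd hG) h1 fun N =>
    integral_linePoly_le ha σ.2 N hG

theorem posLog_le_log_one_add (x : ℂ) : Real.posLog ‖x‖ ≤ Real.log (1 + ‖x‖) := by
  rw [Real.posLog_eq_log_max_one (norm_nonneg _)]
  refine Real.log_le_log (by positivity) (max_le ?_ ?_) <;> linarith [norm_nonneg x]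

theorem memNevanlinna_of_lt_top {F : D1 → ℂ} (hF : IsHolomorphic F) (h : nevanlinnaNorm F < ⊤) :
    MemNevanlinna F :=
  ⟨hF, lt_of_le_of_lt (iSup_mono fun _ => lintegral_mono fun _ =>
    ENNReal.ofReal_le_ofReal (posLog_le_log_one_add _)) h⟩

theorem memNevanlinna_bohrLift {a : ArithmeticFunction ℂ} (ha : MemNu a) :
    MemNevanlinna (bohrLift a) :=
  memNevanlinna_of_lt_top (isHolomorphic_bohrLift ha)
    ((nevanlinnaNorm_bohrLift_le ha).trans_lt ha.2)

/-! ### Point evaluations on the Nevanlinna class -/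

theorem norm_scaled_le {r : ℝ} (hr : r ∈ Ioo (0 : ℝ) 1) {z : ℕ → ℂ} (hz : z ∈ closedPolydisc)
    (j : ℕ) : ‖((r ^ (j + 1) : ℝ) : ℂ) * z j‖ ≤ r ^ (j + 1) := by
  rw [norm_mul, Complex.norm_real, Real.norm_of_nonneg (pow_nonneg hr.1.le _)]
  exact mul_le_of_le_one_right (pow_nonneg hr.1.le _) (hz j)

/-- The point `(r z_1, r² z_2, …)` of `𝔻₁^∞`, for `z` in the closed polydisc. It extends `dilate`
from the torus to the polydisc. -/
noncomputable def scaledPoint (r : Ioo (0 : ℝ) 1) (z : closedPolydisc) : D1 :=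
  ⟨⟨fun j => (((r : ℝ) ^ (j + 1) : ℝ) : ℂ) * z.1 j, memℓp_gen (by
      simpa using (summable_dilate r.2).of_nonneg_of_le (fun j => norm_nonneg _)
        (norm_scaled_le r.2 z.2))⟩,
    fun j => (norm_scaled_le r.2 z.2 j).trans_lt (pow_lt_one₀ r.2.1.le r.2.2 (by omega))⟩

theorem scaledPoint_apply (r : Ioo (0 : ℝ) 1) (z : closedPolydisc) (j : ℕ) :
    (scaledPoint r z : Ell1) j = (((r : ℝ) ^ (j + 1) : ℝ) : ℂ) * z.1 j := rfl

theorem scaledPoint_torusPoint (r : Ioo (0 : ℝ) 1) (w : ℕ → UnitAddCircle) :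
    scaledPoint r ⟨torusPoint w, torusPoint_mem w⟩ = dilate r w :=
  Subtype.ext (lp.ext (coe_dilate r w).symm)

theorem continuous_scaledPoint (r : Ioo (0 : ℝ) 1) : Continuous (scaledPoint r) := by
  refine continuous_iff_continuousAt.2 fun z₀ => ?_
  rw [ContinuousAt, tendsto_subtype_rng, tendsto_iff_norm_sub_tendsto_zero]
  simp only [norm_ell1_eq_tsum, ell1_sub_apply, scaledPoint_apply]
  have hc : Continuous fun z : closedPolydisc => ∑' j : ℕ,
      ‖(((r : ℝ) ^ (j + 1) : ℝ) : ℂ) * z.1 j - (((r : ℝ) ^ (j + 1) : ℝ) : ℂ) * z₀.1 j‖ := by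
    refine continuous_tsum (u := fun j : ℕ => (r : ℝ) ^ (j + 1) + (r : ℝ) ^ (j + 1)) (fun j => ?_)
      ((summable_dilate r.2).add (summable_dilate r.2)) (fun j z => ?_)
    · have h1 : Continuous fun z : closedPolydisc => z.1 j :=
        (continuous_apply j).comp continuous_subtype_val
      exact ((continuous_const.mul h1).sub continuous_const).norm
    · rw [norm_norm]
      exact (norm_sub_le _ _).trans
        (add_le_add (norm_scaled_le r.2 z.2 j) (norm_scaled_le r.2 z₀.2 j))
  simpa using hc.tendsto z₀

open Classical in
/-- The function `z ↦ F(r z_1, r² z_2, …)` on the closed polydisc, extended by `0`. -/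
noncomputable def scaledFun (F : D1 → ℂ) (r : Ioo (0 : ℝ) 1) (z : ℕ → ℂ) : ℂ :=
  if hz : z ∈ closedPolydisc then F (scaledPoint r ⟨z, hz⟩) else 0

theorem scaledFun_of_mem (F : D1 → ℂ) (r : Ioo (0 : ℝ) 1) {z : ℕ → ℂ} (hz : z ∈ closedPolydisc) :
    scaledFun F r z = F (scaledPoint r ⟨z, hz⟩) := dif_pos hz

theorem inPolydiscAlgebra_scaledFun {F : D1 → ℂ} (hF : IsHolomorphic F) (r : Ioo (0 : ℝ) 1) :
    InPolydiscAlgebra (scaledFun F r) := by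
  refine ⟨?_, fun z hz j => ?_⟩
  · rw [continuousOn_iff_continuous_domRestrict]
    have : closedPolydisc.domRestrict (scaledFun F r) = fun z => F (scaledPoint r z) := by
      funext z
      exact scaledFun_of_mem F r z.2
    rw [this]
    exact (hF.continuous isOpen_D1).comp (continuous_scaledPoint r)
  · have hu : ∀ x : ℂ, ‖x‖ ≤ 1 → Function.update z j x ∈ closedPolydisc := fun x hx =>
      update_mem_closedPolydisc hz j hx
    have h0 := hu 0 (by simp)
    let v : Ell1 := lp.single 1 j (((r : ℝ) ^ (j + 1) : ℝ) : ℂ)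
    have hline : ∀ (x : ℂ) (hx : ‖x‖ ≤ 1),
        (scaledPoint r ⟨_, h0⟩ : Ell1) + x • v = scaledPoint r ⟨_, hu x hx⟩ := by
      intro x hx
      refine lp.ext (funext fun i => ?_)
      rw [ell1_add_smul_apply, scaledPoint_apply, scaledPoint_apply]
      rcases eq_or_ne i j with rfl | hij
      · simp [v, mul_comm]
      · simp [v, hij]
    have hd := hF.2 (scaledPoint r ⟨_, h0⟩) v
    have hsub : ∀ x ∈ Metric.ball (0 : ℂ) 1, ‖x‖ ≤ 1 := fun x hx => by
      simpa using (Metric.mem_ball.1 hx).le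
    refine (hd.mono fun x hx => ?_).congr fun x hx => ?_
    · change _ ∈ D1
      rw [hline x (hsub x hx)]
      exact (scaledPoint r _).2
    · rw [scaledFun_of_mem F r (hu x (hsub x hx)), hline x (hsub x hx),
        Subtype.val_injective.extend_apply]

theorem integral_scaledFun_le {F : D1 → ℂ} (hF : IsHolomorphic F) (hfin : nevanlinnaNorm F < ⊤)
    (r : Ioo (0 : ℝ) 1) :
    ∫ w, logOneAdd (scaledFun F r (torusPoint w)) ∂torusMeasure ≤ (nevanlinnaNorm F).toReal := by
  have h := ofReal_integral_le_nevanlinnaNorm hF r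
  rw [ENNReal.ofReal_le_iff_le_toReal hfin.ne] at h
  refine le_of_eq_of_le (integral_congr_ae (Eventually.of_forall fun w => ?_)) h
  simp only [scaledFun_of_mem F r (torusPoint_mem w), scaledPoint_torusPoint]

theorem logOneAdd_le_of_finite_support {F : D1 → ℂ} (hF : IsHolomorphic F)
    (hfin : nevanlinnaNorm F < ⊤) (ζ : D1) {m : ℕ} (hm : ∀ j, m ≤ j → (ζ : Ell1) j = 0) :
    logOneAdd (F ζ) ≤ Real.exp (∑ j ∈ Finset.range m,
      2 * ‖(ζ : Ell1) j‖ / (1 - ‖(ζ : Ell1) j‖)) * (nevanlinnaNorm F).toReal := by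
  let s : ℝ → ℕ → ℂ := fun r j => ((r ^ (j + 1) : ℝ) : ℂ)⁻¹ * (ζ : Ell1) j
  have hsc : ∀ j, Tendsto (fun r => ‖s r j‖) (𝓝[<] 1) (𝓝 ‖(ζ : Ell1) j‖) := fun j => by
    have h1 : ContinuousAt (fun r : ℝ => ‖s r j‖) 1 := by
      refine ContinuousAt.norm (ContinuousAt.mul (ContinuousAt.inv₀ ?_ (by simp)) continuousAt_const)
      fun_prop
    have h2 : Tendsto (fun r => ‖s r j‖) (𝓝[<] 1) (𝓝 ‖s 1 j‖) := h1.mono_left nhdsWithin_le_nhds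
    simpa [s] using h2
  have hlim : Tendsto (fun r => Real.exp (∑ j ∈ Finset.range m, 2 * ‖s r j‖ / (1 - ‖s r j‖)) *
      (nevanlinnaNorm F).toReal) (𝓝[<] 1) (𝓝 (Real.exp (∑ j ∈ Finset.range m,
        2 * ‖(ζ : Ell1) j‖ / (1 - ‖(ζ : Ell1) j‖)) * (nevanlinnaNorm F).toReal)) := by
    refine Tendsto.mul_const _ ((Real.continuous_exp.tendsto _).comp
      (tendsto_finsetSum _ fun j _ => ?_))
    have h1 : 1 - ‖(ζ : Ell1) j‖ ≠ 0 := by have := ζ.2 j; linarith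
    exact ((hsc j).const_mul 2).div (tendsto_const_nhds.sub (hsc j)) h1
  refine ge_of_tendsto hlim ?_
  have hev : ∀ᶠ r in 𝓝[<] (1 : ℝ), ∀ j ∈ Finset.range m, ‖s r j‖ < 1 :=
    (Finset.eventually_all _).2 fun j _ => (hsc j).eventually_lt_const (ζ.2 j)
  have hpos : ∀ᶠ r in 𝓝[<] (1 : ℝ), 0 < r :=
    nhdsWithin_le_nhds (lt_mem_nhds one_pos)
  filter_upwards [hev, hpos, self_mem_nhdsWithin] with r hrs hr0 hr1
  let r' : Ioo (0 : ℝ) 1 := ⟨r, hr0, hr1⟩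
  have hs1 : ∀ j, ‖s r j‖ < 1 := fun j => by
    by_cases hj : j < m
    · exact hrs j (Finset.mem_range.2 hj)
    · simp [s, hm j (not_lt.1 hj)]
  have hsK : s r ∈ closedPolydisc := fun j => (hs1 j).le
  have hsζ : scaledPoint r' ⟨s r, hsK⟩ = ζ := by
    refine Subtype.ext (lp.ext (funext fun j => ?_))
    rw [scaledPoint_apply]
    have : ((r ^ (j + 1) : ℝ) : ℂ) ≠ 0 := by
      exact_mod_cast pow_ne_zero _ hr0.ne'
    exact mul_inv_cancel_left₀ this _
  have h := (inPolydiscAlgebra_scaledFun hF r').logOneAdd_le_exp hs1 (m := m)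
    fun j hj => by simp [s, hm j hj]
  rw [scaledFun_of_mem F r' hsK, hsζ] at h
  exact h.trans (mul_le_mul_of_nonneg_left (integral_scaledFun_le hF hfin r') (Real.exp_pos _).le)

/-- Point evaluations are controlled by the norm of the Nevanlinna class, locally uniformly in
`𝔻₁^∞`. -/
theorem logOneAdd_le_nevanlinnaNorm {F : D1 → ℂ} (hF : IsHolomorphic F)
    (hfin : nevanlinnaNorm F < ⊤) (ζ : D1) {R : ℝ} (hR : R < 1) (hζ : ∀ j, ‖(ζ : Ell1) j‖ ≤ R) :
    logOneAdd (F ζ) ≤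
      Real.exp (2 * ‖(ζ : Ell1)‖ / (1 - R)) * (nevanlinnaNorm F).toReal := by
  -- `T m` is the truncation of `ζ` to the first `m` coordinates
  let T : ℕ → Ell1 := fun m => ∑ j ∈ Finset.range m, lp.single 1 j ((ζ : Ell1) j)
  have hTj : ∀ m i, T m i = if i < m then (ζ : Ell1) i else 0 := fun m i => by
    simp only [T, lp.coeFn_sum, Finset.sum_apply, lp.coeFn_single, Pi.single_apply]
    simp
  have hTD : ∀ m, T m ∈ D1 := fun m i => by
    rw [hTj]
    split_ifs
    · exact ζ.2 i
    · simp
  have hT : Tendsto (fun m => (⟨T m, hTD m⟩ : D1)) atTop (𝓝 ζ) := by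
    rw [tendsto_subtype_rng]
    exact (lp.hasSum_single (by simp) (ζ : Ell1)).tendsto_sum_nat
  have hlim := ((continuous_logOneAdd.comp (hF.continuous isOpen_D1)).tendsto ζ).comp hT
  refine le_of_tendsto' hlim fun m => ?_
  refine (logOneAdd_le_of_finite_support hF hfin ⟨T m, hTD m⟩ (m := m) fun j hj => ?_).trans
    (mul_le_mul_of_nonneg_right (Real.exp_le_exp.2 ?_) ENNReal.toReal_nonneg)
  · rw [hTj, if_neg (not_lt.2 hj)]
  · have hR' : 0 < 1 - R := by linarith
    calc _ ≤ ∑ j ∈ Finset.range m, 2 * ‖(ζ : Ell1) j‖ / (1 - R) := by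
          refine Finset.sum_le_sum fun j hj => ?_
          rw [hTj, if_pos (Finset.mem_range.1 hj)]
          exact div_le_div_of_nonneg_left (by positivity) hR' (by linarith [hζ j])
      _ = 2 * (∑ j ∈ Finset.range m, ‖(ζ : Ell1) j‖) / (1 - R) := by
          rw [← Finset.sum_div, ← Finset.mul_sum]
      _ ≤ _ := div_le_div_of_nonneg_right (mul_le_mul_of_nonneg_left
          (sum_norm_le_norm_ell1 _ _) two_pos.le) hR'.le

/-- The local form of the estimate of point evaluations, for the differences of functions of the
Nevanlinna class. -/
theorem exists_norm_sub_le (ζ : D1) : ∃ δ > 0, ∃ C : ℝ, ∀ (F G : Nevanlinna) (η : D1),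
    ‖(η : Ell1) - ζ‖ < δ → ‖F.1 η - G.1 η‖ ≤ Real.exp (C * dist F G) - 1 := by
  obtain ⟨R, hR, δ, hδ, h⟩ := exists_radius ζ
  have hR' : 0 < 1 - R := by linarith [hR.2]
  refine ⟨δ, hδ, Real.exp (2 * (‖(ζ : Ell1)‖ + δ) / (1 - R)), fun F G η hη => ?_⟩
  have h1 := logOneAdd_le_nevanlinnaNorm (F.2.1.sub G.2.1) (nevanlinnaNorm_sub_lt_top F G) η hR.2
    (h η hη)
  have h2 : ‖(η : Ell1)‖ ≤ ‖(ζ : Ell1)‖ + δ := by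
    have := norm_add_le ((η : Ell1) - ζ) ζ
    rw [sub_add_cancel] at this
    linarith
  have h3 : logOneAdd ((F.1 - G.1) η) ≤
      Real.exp (2 * (‖(ζ : Ell1)‖ + δ) / (1 - R)) * dist F G := by
    refine h1.trans (mul_le_mul_of_nonneg_right (Real.exp_le_exp.2 ?_) ENNReal.toReal_nonneg)
    gcongr
  have h4 := Real.exp_le_exp.2 h3
  rw [exp_logOneAdd, Pi.sub_apply] at h4
  linarith

/-! ### The Nevanlinna class is a complete metric space -/

instance : T0Space Nevanlinna := by
  refine ⟨fun F G h => Subtype.ext (funext fun ζ => ?_)⟩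
  obtain ⟨δ, hδ, C, hC⟩ := exists_norm_sub_le ζ
  have h1 := hC F G ζ (by simpa using hδ)
  rw [Metric.inseparable_iff.1 h, mul_zero, Real.exp_zero, sub_self] at h1
  exact sub_eq_zero.1 (norm_le_zero_iff.1 h1)

/-- A Cauchy sequence of the Nevanlinna class converges pointwise, and uniformly near every point. -/
theorem exists_tendstoUniformlyOn {u : ℕ → Nevanlinna} (hu : CauchySeq u) :
    ∃ F : D1 → ℂ, (∀ ζ, Tendsto (fun n => (u n).1 ζ) atTop (𝓝 (F ζ))) ∧
      ∀ ζ : D1, ∃ δ > 0, TendstoUniformlyOn (fun n => (u n).1) F atTop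
        {η : D1 | ‖(η : Ell1) - ζ‖ < δ} := by
  have hloc : ∀ ζ : D1, ∃ δ > 0, UniformCauchySeqOn (fun n => (u n).1) atTop
      {η : D1 | ‖(η : Ell1) - ζ‖ < δ} := by
    intro ζ
    obtain ⟨δ, hδ, C, hC⟩ := exists_norm_sub_le ζ
    refine ⟨δ, hδ, Metric.uniformCauchySeqOn_iff.2 fun ε hε => ?_⟩
    have hcont : Tendsto (fun d : ℝ => Real.exp (C * d) - 1) (𝓝 0) (𝓝 0) := by
      have h1 : Continuous fun d : ℝ => Real.exp (C * d) - 1 := by fun_prop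
      simpa using h1.tendsto 0
    obtain ⟨d, hd, hdε⟩ := Metric.eventually_nhds_iff.1 (hcont.eventually_lt_const hε)
    obtain ⟨N, hN⟩ := Metric.cauchySeq_iff.1 hu d hd
    refine ⟨N, fun m hm n hn η hη => ?_⟩
    rw [dist_eq_norm]
    refine (hC (u m) (u n) η hη).trans_lt (hdε ?_)
    rw [Real.dist_eq, sub_zero, abs_of_nonneg dist_nonneg]
    exact hN m hm n hn
  have hpt : ∀ ζ, ∃ y, Tendsto (fun n => (u n).1 ζ) atTop (𝓝 y) := fun ζ => by
    obtain ⟨δ, hδ, h⟩ := hloc ζ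
    exact cauchySeq_tendsto_of_complete (h.cauchySeq (by simpa using hδ))
  choose F hF using hpt
  refine ⟨F, hF, fun ζ => ?_⟩
  obtain ⟨δ, hδ, h⟩ := hloc ζ
  exact ⟨δ, hδ, h.tendstoUniformlyOn_of_tendsto fun η _ => hF η⟩

theorem isHolomorphic_of_tendstoUniformlyOn {F : ℕ → D1 → ℂ} {G : D1 → ℂ}
    (hF : ∀ n, IsHolomorphic (F n)) (h : ∀ ζ : D1, ∃ δ > 0, TendstoUniformlyOn F G atTop
      {η : D1 | ‖(η : Ell1) - ζ‖ < δ}) : IsHolomorphic G := by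
  refine ⟨fun ζ => ?_, fun ζ₀ ξ => ?_⟩
  · obtain ⟨δ, hδ, hu⟩ := h ζ
    obtain ⟨N, hN⟩ := (Metric.tendstoUniformlyOn_iff.1 hu 1 one_pos).exists
    obtain ⟨U, hU, M, hM⟩ := (hF N).1 ζ
    refine ⟨U ∩ Metric.ball ζ δ, inter_mem hU (Metric.ball_mem_nhds _ hδ), M + 1, fun η hη => ?_⟩
    have h1 := hN η (show ‖(η : Ell1) - ζ‖ < δ by rw [← dist_eq_norm]; exact hη.2)
    rw [dist_eq_norm] at h1
    have h2 := norm_add_le (F N η) (G η - F N η)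
    rw [add_sub_cancel] at h2
    linarith [hM η hη.1]
  · have hc : Continuous fun z : ℂ => (ζ₀ : Ell1) + z • ξ := by fun_prop
    refine TendstoLocallyUniformlyOn.differentiableOn (φ := atTop)
      (F := fun n z => Function.extend Subtype.val (F n) 0 ((ζ₀ : Ell1) + z • ξ)) ?_
      (Eventually.of_forall fun n => (hF n).2 ζ₀ ξ) (isOpen_D1.preimage hc)
    rw [Metric.tendstoLocallyUniformlyOn_iff]
    intro ε hε z hz
    obtain ⟨δ, hδ, hu⟩ := h ⟨_, hz⟩
    refine ⟨{z | (ζ₀ : Ell1) + z • ξ ∈ D1} ∩ (fun z : ℂ => (ζ₀ : Ell1) + z • ξ) ⁻¹'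
      Metric.ball ((ζ₀ : Ell1) + z • ξ) δ, inter_mem self_mem_nhdsWithin
        (mem_nhdsWithin_of_mem_nhds (hc.continuousAt (Metric.ball_mem_nhds _ hδ))), ?_⟩
    filter_upwards [Metric.tendstoUniformlyOn_iff.1 hu ε hε] with n hn x hx
    have hx1 : (ζ₀ : Ell1) + x • ξ ∈ D1 := hx.1
    have e : ∀ H : D1 → ℂ, Function.extend Subtype.val H 0 ((ζ₀ : Ell1) + x • ξ) = H ⟨_, hx1⟩ :=
      fun H => Subtype.val_injective.extend_apply H 0 ⟨_, hx1⟩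
    rw [e, e]
    refine hn ⟨_, hx1⟩ ?_
    have := hx.2
    rwa [mem_preimage, Metric.mem_ball, dist_eq_norm] at this

instance : CompleteSpace Nevanlinna := by
  refine Metric.complete_of_cauchySeq_tendsto fun u hu => ?_
  obtain ⟨F, hF, hFu⟩ := exists_tendstoUniformlyOn hu
  have hhol : IsHolomorphic F := isHolomorphic_of_tendstoUniformlyOn (fun n => (u n).2.1) hFu
  -- by Fatou's lemma, the norm is lower semicontinuous under pointwise convergence
  have hnorm : ∀ ε > 0, ∃ N, ∀ n ≥ N, nevanlinnaNorm (F - (u n).1) ≤ ENNReal.ofReal ε := by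
    intro ε hε
    obtain ⟨N, hN⟩ := Metric.cauchySeq_iff.1 hu ε hε
    refine ⟨N, fun n hn => iSup_le fun r => ?_⟩
    have hptw : ∀ w, Tendsto (fun k => ENNReal.ofReal
        (Real.log (1 + ‖((u k).1 - (u n).1) (dilate r w)‖))) atTop
        (𝓝 (ENNReal.ofReal (Real.log (1 + ‖(F - (u n).1) (dilate r w)‖)))) := fun w =>
      (ENNReal.continuous_ofReal.tendsto _).comp ((continuous_logOneAdd.tendsto _).comp
        ((hF (dilate r w)).sub_const _))
    calc _ = ∫⁻ w, liminf (fun k => ENNReal.ofReal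
          (Real.log (1 + ‖((u k).1 - (u n).1) (dilate r w)‖))) atTop ∂torusMeasure :=
          lintegral_congr fun w => (hptw w).liminf_eq.symm
      _ ≤ liminf (fun k => ∫⁻ w, ENNReal.ofReal
          (Real.log (1 + ‖((u k).1 - (u n).1) (dilate r w)‖)) ∂torusMeasure) atTop := by
          refine lintegral_liminf_le fun k => ?_
          have := measurable_dilate r _ (((u k).2.1.sub (u n).2.1).continuous isOpen_D1)
          fun_prop
      _ ≤ ENNReal.ofReal ε := by
          refine liminf_le_of_frequently_le' (Eventually.frequently ?_)
          filter_upwards [eventually_ge_atTop N] with k hk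
          refine (le_iSup (fun r : Ioo (0 : ℝ) 1 => ∫⁻ w, ENNReal.ofReal
            (Real.log (1 + ‖((u k).1 - (u n).1) (dilate r w)‖)) ∂torusMeasure) r).trans ?_
          have h1 : (nevanlinnaNorm ((u k).1 - (u n).1)).toReal < ε := hN k hk n hn
          exact (ENNReal.le_ofReal_iff_toReal_le (nevanlinnaNorm_sub_lt_top _ _).ne hε.le).2 h1.le
  have hfin : nevanlinnaNorm F < ⊤ := by
    obtain ⟨N, hN⟩ := hnorm 1 one_pos
    have h1 := nevanlinnaNorm_triangle (G := 0) hhol (u N).2.1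
    rw [sub_zero, sub_zero] at h1
    exact h1.trans_lt (ENNReal.add_lt_top.2
      ⟨(hN N le_rfl).trans_lt ENNReal.ofReal_lt_top, nevanlinnaNorm_lt_top (u N).2⟩)
  let L : Nevanlinna := ⟨F, memNevanlinna_of_lt_top hhol hfin⟩
  refine ⟨L, Metric.tendsto_atTop.2 fun ε hε => ?_⟩
  obtain ⟨N, hN⟩ := hnorm (ε / 2) (half_pos hε)
  refine ⟨N, fun n hn => lt_of_le_of_lt ?_ (half_lt_self hε)⟩
  rw [dist_comm]
  exact ENNReal.toReal_le_of_le_ofReal (half_pos hε).le (hN n hn)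

/-! ### The isometry -/

theorem memNu_sub (f g : Nu) : MemNu (f.1 - g.1) :=
  ⟨abscissaUnif_sub f.2.1 g.2.1, dirichletNorm_sub_lt_top f g⟩

theorem bohrLift_sub (f g : Nu) : bohrLift (f.1 - g.1) = bohrLift f.1 - bohrLift g.1 := by
  funext ζ
  have h : ∀ n, (f.1 - g.1) n = f.1 n - g.1 n := fun n => by
    rw [sub_eq_add_neg, sub_eq_add_neg]; rfl
  simp only [bohrLift, Pi.sub_apply, h, sub_mul]
  exact (summable_norm_bohr f.2 ζ).of_norm.tsum_sub (summable_norm_bohr g.2 ζ).of_norm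

/-- The Bohr lift as a map from `𝒩_u` to the Nevanlinna class. -/
noncomputable def bohrMap (f : Nu) : Nevanlinna := ⟨bohrLift f.1, memNevanlinna_bohrLift f.2⟩

theorem isometry_bohrMap : Isometry bohrMap := by
  refine Isometry.of_dist_eq fun f g => ?_
  change (nevanlinnaNorm (bohrLift f.1 - bohrLift g.1)).toReal = (dirichletNorm (f.1 - g.1)).toReal
  rw [← bohrLift_sub, nevanlinnaNorm_bohrLift (memNu_sub f g)]

end BohrNevanlinna

open BohrNevanlinna in
theorem theorem4p1 :
    (∀ a : ArithmeticFunction ℂ, abscissaUnif a ≤ 0 → ∀ σ : ℝ, 0 < σ →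
      Tendsto (fun T : ℝ => verticalMean a σ T) atTop (𝓝 (lineNorm a σ))) ∧
    (∀ a : ArithmeticFunction ℂ, MemNu a →
      (∀ ζ : D1, Summable fun n : ℕ => a n * bohrMonomial n ζ) ∧
      MemNevanlinna (bohrLift a) ∧
      nevanlinnaNorm (bohrLift a) = dirichletNorm a) ∧
    ∃! Φ : NevanlinnaDirichlet → Nevanlinna,
      Isometry Φ ∧ ∀ f : Nu, (Φ (f : NevanlinnaDirichlet)).1 = bohrLift f.1 := by
  refine ⟨fun a ha σ hσ => ?_, fun a ha => ⟨fun ζ => (summable_norm_bohr ha ζ).of_norm,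
    memNevanlinna_bohrLift ha, nevanlinnaNorm_bohrLift ha⟩,
    UniformSpace.Completion.extension bohrMap,
    ⟨isometry_bohrMap.completion_extension, fun f => ?_⟩, fun Ψ hΨ => ?_⟩
  · obtain ⟨G, -, hG⟩ := exists_tendsto_linePoly ha hσ
    rw [lineNorm_eq hG]
    exact tendsto_verticalMean hG
  · rw [UniformSpace.Completion.extension_coe isometry_bohrMap.uniformContinuous]
    rfl
  · refine UniformSpace.Completion.ext hΨ.1.continuous
      isometry_bohrMap.completion_extension.continuous fun f => ?_
    rw [UniformSpace.Completion.extension_coe isometry_bohrMap.uniformContinuous]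
    exact Subtype.ext (hΨ.2 f)
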